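/- Let $\mathcal C$ be a pointed model category with all small colimits, and let $\mathcal C$ carry a symmetric monoidal structure $(\wedge,\mathbb I)$ making it a monoidal model category. That is: $\wedge$ commutes with colimits in each variable; for cofibrations $i\colon A\to B$ and $j\colon X\to Y$ the pushout product $A\wedge Y\cup_{A\wedge X}B\wedge X\to B\wedge Y$ is a cofibration, which is a weak equivalence if $i$ or $j$ is one; and there is a trivial fibration $q\colon Q\mathbb I\to\mathbb I$ with $Q\mathbb I$ cofibrant such that $q\wedge X$ is a weak equivalence for every cofibrant $X$. Let $\mathcal C^{\Delta}$ be the category of cosimplicial objects of $\mathcal C$. For $X\in\mathcal C^{\Delta}$ and a pointed simplicial set $K$, let $X\otimes_\Delta K$ be the coend $\int^{k\in\Delta}K_k\cdot X^k$ in $\mathcal C$, where, for a pointed set $P$ and an object $Z$, $P\cdot Z$ is the coproduct of copies of $Z$ indexed by the elements of $P$ other than the base point. Let $X\otimes K\in\mathcal C^{\Delta}$ be given by $(X\otimes K)^n=X\otimes_\Delta(K\wedge\Delta[n]_+)$, and put $\Sigma X=X\otimes S^1$ with $S^1=\Delta[1]/\partial\Delta[1]$. For $X,Y\in\mathcal C^\Delta$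 the product $X\wedge Y$ is formed levelwise, $(X\wedge Y)^n=X^n\wedge Y^n$. A map in $\mathcal C^\Delta$ is a level equivalence if it is a weak equivalence in each degree. An object $A\in\mathcal C^{\Delta}$ is a cosimplicial resolution if it is Reedy cofibrant, that is, $A\otimes_\Delta\partial\Delta[k]_+\to A\otimes_\Delta\Delta[k]_+\cong A^k$ is a cofibration for every $k\ge 0$, and if all its coface and codegeneracy maps are weak equivalences. Then: 1. If $A$ and $B$ are cosimplicial resolutions, then $A\wedge B$ is a cosimplicial resolution. 2. If $A$ is a cosimplicial resolution, then $\Sigma A$ is a cosimplicial resolution. 3. There are maps $\varphi_{A,B}\colon\Sigma(A\wedge B)\to(\Sigma A)\wedge B$ in $\mathcal C^{\Delta}$, defined for all cosimplicial objects $A,B$ and natural in both, such that $\varphi_{A,B}$ is a level equivalence whenever $A$ and $B$ are cosimplicial resolutions. -/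

import Mathlib

open CategoryTheory Limits MonoidalCategory HomotopicalAlgebra Simplicial Opposite

universe v u

noncomputable section

namespace CosimplicialResolutions

/-! ### Monoidal model categories -/

/-- A symmetric monoidal structure on a model category `C` makes it a monoidal model category if
the product commutes with colimits in each variable (by symmetry the condition on `X ⊗ -` is
enough), and the pushout product axiom and the unit axiom hold. Only colimits indexed by
categories in `Type` are asked to be preserved. -/
class IsMonoidalModelCategory (C : Type u) [Category.{v} C] [ModelCategory C]
    [MonoidalCategory C] [SymmetricCategory C] : Prop where
  preservesColimits (X : C) : PreservesColimitsOfSize.{0, 0} (tensorLeft X)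
  /-- The pushout product of two cofibrations is a cofibration. -/
  cofibration_pushoutProduct {A B X Y : C} (i : A ⟶ B) (j : X ⟶ Y)
    [Cofibration i] [Cofibration j] :
    Cofibration ((Arrow.pushoutProduct.obj (Arrow.mk i)).obj (Arrow.mk j)).hom
  /-- The pushout product of two cofibrations, one of which is a weak equivalence, is a weak
  equivalence. -/
  weakEquivalence_pushoutProduct {A B X Y : C} (i : A ⟶ B) (j : X ⟶ Y)
    [Cofibration i] [Cofibration j] (h : WeakEquivalence i ∨ WeakEquivalence j) :
    WeakEquivalence ((Arrow.pushoutProduct.obj (Arrow.mk i)).obj (Arrow.mk j)).hom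
  /-- Unit axiom. -/
  exists_unit_replacement : ∃ (Q : C) (q : Q ⟶ 𝟙_ C), IsCofibrant Q ∧ Fibration q ∧
    WeakEquivalence q ∧ ∀ (X : C), IsCofibrant X → WeakEquivalence (q ▷ X)

/-! ### Pointed sets and pointed simplicial sets -/

/-- The pointed set `T / S` obtained from `T` by collapsing the subset `S` to a base point (and by
adding a disjoint base point if `S` is empty). Its elements are the base point `none` and the
elements of `T` that are not in `S`. -/
def collapse {T : Type} (S : Set T) : Pointed.{0} := ⟨Option {t : T // t ∉ S}, none⟩

open Classical in
/-- The map `T / S → T' / S'` induced by a map `f : T → T'` with `f(S) ⊆ S'`. -/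
def collapseMap {T T' : Type} {S : Set T} {S' : Set T'} (f : T → T')
    (_hf : ∀ t ∈ S, f t ∈ S') : collapse S ⟶ collapse S' where
  toFun
    | none => none
    | some t => if h : f t.1 ∈ S' then none else some ⟨f t.1, h⟩
  map_point := rfl

theorem collapseMap_id {T : Type} {S : Set T} (f : T → T) (hf : ∀ t ∈ S, f t ∈ S)
    (h : ∀ t, f t = t) : collapseMap f hf = 𝟙 (collapse S) := by
  classical
  apply Pointed.Hom.ext
  funext t
  rcases t with _ | ⟨t, ht⟩
  · rfl
  · have h' : f t ∉ S := by rwa [h t]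
    exact (dif_neg h').trans (congrArg some (Subtype.ext (h t)))

theorem collapseMap_comp {T T' T'' : Type} {S : Set T} {S' : Set T'} {S'' : Set T''}
    (f : T → T') (hf : ∀ t ∈ S, f t ∈ S') (g : T' → T'') (hg : ∀ t ∈ S', g t ∈ S'')
    (k : T → T'') (hk : ∀ t ∈ S, k t ∈ S'') (h : ∀ t, k t = g (f t)) :
    collapseMap k hk = collapseMap f hf ≫ collapseMap g hg := by
  classical
  obtain rfl : k = fun t ↦ g (f t) := funext h
  apply Pointed.Hom.ext
  funext t
  rcases t with _ | ⟨t, ht⟩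
  · rfl
  · by_cases h1 : f t ∈ S'
    · have h2 : (collapseMap f hf).toFun (some ⟨t, ht⟩) = none := dif_pos h1
      exact (dif_pos (hg _ h1)).trans (congrArg (collapseMap g hg).toFun h2).symm
    · have h2 : (collapseMap f hf).toFun (some ⟨t, ht⟩) = some ⟨f t, h1⟩ := dif_neg h1
      exact (congrArg (collapseMap g hg).toFun h2).symm

/-- The smash product `P ∧ Q = (P × Q) / (P ∨ Q)` of pointed sets. -/
def smash (P Q : Pointed.{0}) : Pointed.{0} :=
  collapse ({p | p.1 = P.point ∨ p.2 = Q.point} : Set (P.X × Q.X))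

/-- The smash product of pointed maps. -/
def smashMap {P P' Q Q' : Pointed.{0}} (f : P ⟶ P') (g : Q ⟶ Q') : smash P Q ⟶ smash P' Q' :=
  collapseMap (fun p ↦ (f.toFun p.1, g.toFun p.2)) (by
    rintro ⟨p, q⟩ (h | h)
    · exact Or.inl (by rw [show p = _ from h]; exact f.map_point)
    · exact Or.inr (by rw [show q = _ from h]; exact g.map_point))

theorem smashMap_id (P Q : Pointed.{0}) : smashMap (𝟙 P) (𝟙 Q) = 𝟙 (smash P Q) :=
  collapseMap_id _ _ fun _ ↦ rfl

theorem smashMap_comp {P P' P'' Q Q' Q'' : Pointed.{0}} (f : P ⟶ P') (f' : P' ⟶ P'')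
    (g : Q ⟶ Q') (g' : Q' ⟶ Q'') :
    smashMap (f ≫ f') (g ≫ g') = smashMap f g ≫ smashMap f' g' :=
  collapseMap_comp _ _ _ _ _ _ fun _ ↦ rfl

/-- Pointed simplicial sets, as simplicial objects in pointed sets. -/
abbrev PSSet : Type 1 := SimplexCategoryᵒᵖ ⥤ Pointed.{0}

/-- The functor `K ↦ K₊` adding a disjoint base point to a simplicial set. -/
def plus : SSet.{0} ⥤ PSSet := (Functor.whiskeringRight _ _ _).obj typeToPointed

/-- The quotient `K / L` of a simplicial set by a subcomplex, pointed by the image of `L`. -/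
def quotient (K : SSet.{0}) (L : K.Subcomplex) : PSSet where
  obj n := collapse (L.obj n)
  map f := collapseMap (fun t ↦ K.map f t) (fun _ ht ↦ L.map f ht)
  map_id _ := collapseMap_id _ _ fun _ ↦ by simp
  map_comp _ _ := collapseMap_comp _ _ _ _ _ _ fun _ ↦ by simp

/-- The simplicial circle `S¹ = Δ[1] / ∂Δ[1]`. -/
def circle : PSSet := quotient Δ[1] (SSet.boundary 1)

/-- The functor `K ∧ -` on pointed simplicial sets; the smash product is formed levelwise. -/
def smashLeft (K : PSSet) : PSSet ⥤ PSSet where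
  obj L :=
    { obj n := smash (K.obj n) (L.obj n)
      map f := smashMap (K.map f) (L.map f)
      map_id _ := by rw [K.map_id, L.map_id, smashMap_id]
      map_comp _ _ := by rw [K.map_comp, L.map_comp, smashMap_comp] }
  map g :=
    { app n := smashMap (𝟙 _) (g.app n)
      naturality _ _ f := by
        rw [← smashMap_comp, ← smashMap_comp, g.naturality, Category.comp_id, Category.id_comp] }
  map_id L := by
    refine NatTrans.ext (funext fun n ↦ ?_)
    exact smashMap_id (K.obj n) (L.obj n)
  map_comp g h := by
    refine NatTrans.ext (funext fun n ↦ ?_)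
    exact (congrArg (fun t ↦ smashMap t _) (Category.comp_id (𝟙 (K.obj n))).symm).trans
      (smashMap_comp (𝟙 (K.obj n)) (𝟙 (K.obj n)) (g.app n) (h.app n))

/-! ### Tensors of cosimplicial objects with pointed simplicial sets -/

section Tensor

variable {C : Type u} [Category.{v} C] [HasZeroMorphisms C] [HasColimitsOfSize.{0, 0} C]

open Classical in
/-- For a pointed set `P` and an object `X` of a pointed category, the coproduct `P · X` of copies
of `X` indexed by the elements of `P` other than the base point. A pointed map `f : P ⟶ Q` sends
the copy of `X` at `p` identically to the copy at `f p`, and to zero if `f p` is the base point. -/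
def copower : Pointed.{0} ⥤ C ⥤ C where
  obj P :=
    { obj X := ∐ fun _ : {p : P // p ≠ P.point} ↦ X
      map g := Limits.Sigma.map fun _ ↦ g }
  map {P Q} f :=
    { app X := Limits.Sigma.desc fun p ↦
        if h : f.toFun p.1 = Q.point then 0
        else Limits.Sigma.ι (fun _ : {q : Q // q ≠ Q.point} ↦ X) ⟨f.toFun p.1, h⟩
      naturality X Y g := by
        ext p
        by_cases h : f.toFun p.1 = Q.point <;> simp [h] }
  map_id P := by
    ext X p
    simp [p.2]
  map_comp {P Q R} f g := by
    ext X p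
    by_cases h : f.toFun p.1 = Q.point
    · have : g.toFun Q.point = R.point := g.map_point
      simp [h, this]
    · simp [h]
      rfl

/-- The bifunctor `(k, l) ↦ K_k · X^l`, whose coend is `X ⊗_Δ K`. -/
def coendIntegrand (X : SimplexCategory ⥤ C) (K : PSSet) :
    SimplexCategoryᵒᵖ ⥤ SimplexCategory ⥤ C where
  obj k := X ⋙ copower.obj (K.obj k)
  map f := X.whiskerLeft (copower.map (K.map f))

/-- The functoriality of `coendIntegrand`. -/
def coendIntegrandMap {X Y : SimplexCategory ⥤ C} (f : X ⟶ Y) {K L : PSSet} (g : K ⟶ L) :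
    coendIntegrand X K ⟶ coendIntegrand Y L where
  app k := f ◫ copower.map (g.app k)
  naturality k k' a := by
    ext l : 2
    have h := congrArg (fun t ↦ (copower (C := C)).map t) (g.naturality a)
    simp only [Functor.map_comp] at h
    have h' := NatTrans.congr_app h (X.obj l)
    simp only [NatTrans.comp_app] at h'
    simp [coendIntegrand, reassoc_of% h']

/-- The coend `X ⊗_Δ K`, an object of `C`, for a cosimplicial object `X` of a pointed category `C`
and a pointed simplicial set `K`, as a functor in both variables. -/
def tensorDelta : (SimplexCategory ⥤ C) ⥤ PSSet ⥤ C where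
  obj X :=
    { obj K := coend (coendIntegrand X K)
      map g := coend.map (coendIntegrandMap (𝟙 X) g)
      map_id K := by
        rw [← coend.map_id]
        congr 1
        ext k l : 4
        simp [coendIntegrandMap, coendIntegrand]
      map_comp g h := by
        rw [coend.map_comp]
        congr 1
        ext k l : 4
        simp [coendIntegrandMap, coendIntegrand] }
  map f :=
    { app K := coend.map (coendIntegrandMap f (𝟙 K))
      naturality K L g := by
        dsimp only
        rw [coend.map_comp, coend.map_comp]
        congr 1
        ext k l : 4
        simp [coendIntegrandMap, coendIntegrand] }
  map_id X := by
    ext K : 2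
    change coend.map _ = 𝟙 (coend _)
    rw [← coend.map_id]
    congr 1
    ext k l : 4
    simp [coendIntegrandMap, coendIntegrand]
  map_comp f g := by
    ext K : 2
    change coend.map _ = coend.map _ ≫ coend.map _
    rw [coend.map_comp]
    congr 1
    ext k l : 4
    simp [coendIntegrandMap, coendIntegrand]

/-- The functor `X ↦ X ⊗ K` on cosimplicial objects, `(X ⊗ K)^n = X ⊗_Δ (K ∧ Δ[n]₊)`. -/
def tensor (K : PSSet) : (SimplexCategory ⥤ C) ⥤ (SimplexCategory ⥤ C) :=
  tensorDelta ⋙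
    (Functor.whiskeringLeft _ _ _).obj (SSet.stdSimplex.{0} ⋙ plus ⋙ smashLeft K)

/-- The suspension `ΣX = X ⊗ S¹` of cosimplicial objects. -/
def suspension : (SimplexCategory ⥤ C) ⥤ (SimplexCategory ⥤ C) := tensor circle

/-- The map `X ⊗_Δ ∂Δ[k]₊ ⟶ X ⊗_Δ Δ[k]₊` (whose target is `X^k`). -/
def latchingMap (X : SimplexCategory ⥤ C) (k : ℕ) :
    (tensorDelta.obj X).obj (plus.obj (SSet.boundary.{0} k)) ⟶
      (tensorDelta.obj X).obj (plus.obj Δ[k]) :=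
  (tensorDelta.obj X).map (plus.map (SSet.boundary.{0} k).ι)

end Tensor

/-! ### Cosimplicial resolutions -/

section Resolution

variable {C : Type u} [Category.{v} C]

/-- A level equivalence of cosimplicial objects. -/
def IsLevelEquivalence [CategoryWithWeakEquivalences C] {X Y : SimplexCategory ⥤ C}
    (f : X ⟶ Y) : Prop :=
  ∀ n : ℕ, WeakEquivalence (f.app ⦋n⦌)

/-- Reedy cofibrant cosimplicial objects. -/
def IsReedyCofibrant [HasZeroMorphisms C] [HasColimitsOfSize.{0, 0} C]
    [CategoryWithCofibrations C] (A : SimplexCategory ⥤ C) : Prop :=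
  ∀ k : ℕ, Cofibration (latchingMap A k)

/-- A cosimplicial resolution is a Reedy cofibrant cosimplicial object all of whose coface and
codegeneracy maps are weak equivalences. -/
structure IsCosimplicialResolution [HasZeroMorphisms C] [HasColimitsOfSize.{0, 0} C]
    [ModelCategory C] (A : SimplexCategory ⥤ C) : Prop where
  reedyCofibrant : IsReedyCofibrant A
  weakEquivalence_coface (n : ℕ) (i : Fin (n + 2)) :
    WeakEquivalence (A.map (SimplexCategory.δ i))
  weakEquivalence_codegeneracy (n : ℕ) (i : Fin (n + 1)) :
    WeakEquivalence (A.map (SimplexCategory.σ i))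

end Resolution

end CosimplicialResolutions

end

/-!
A map out of a coend `A ⊗_Δ K` is a natural family of maps `A^m ⟶ Z`, indexed by the simplices of
`K`. All lifting problems below are therefore stated for such families (`Family`), where `K` is a
subcomplex of the nerve of a finite partially ordered set `Q`; the simplices of the nerve are the
objects of the category `Chain Q`. The statement `HasExtension X F G p`, that families extend from
`F` to `G` relative to a map `p`, expresses that `colim_F X ⟶ colim_G X` has the left lifting
property with respect to `p`, and it is proved by attaching one simplex at a time
(`CellLift.hasExtension`, `hasExtension_top`). In particular, if `A` is Reedy cofibrant and `p` is a
trivial fibration, then families extend from every subcomplex (`IsReedyCofibrant.hasExtension`).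

*Products.* For two Reedy cofibrant objects, the same holds for families `A^p ⊗ B^q ⟶ Z` on pairs of
simplices: the cells are now pushout products of latching maps
(`IsReedyCofibrant.hasExtension_externalProduct`). A family on the boundary of the diagonal of
`A ⊗ B` is first extended to the pairs of simplices of `Δ[n]` that lie in a common proper face
(`exists_family_commonFace`), and from there to all pairs; its value at the pair of top simplices
solves the lifting problem for the latching map of `A ⊗ B`.

*Suspensions.* A map out of `(ΣA)^n` is a family on the prism `Δ[1] × Δ[n]` that vanishes on
`∂Δ[1] × Δ[n]`. Reedy cofibrancy of `ΣA` is the extension of families from the boundary of the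
prism. For the weak equivalences, let `P` be the colimit of `A` over the prism and `P'` the colimit
over the open box `Δ[1] × {0} ∪ ∂Δ[1] × Δ[n]`. Attaching shuffles shows that `A^n ⟶ P` is a trivial
cofibration, attaching the two sides shows that `A^1 ⟶ P'` is one, and comparing with `A^0` it
follows that `P' ⟶ P` is a trivial cofibration. Hence so is `(ΣA)^0 ⟶ (ΣA)^n`
(`IsCosimplicialResolution.weakEquivalence_suspension_const`), and all structure maps of `ΣA` are
weak equivalences.

*Comparison.* The map `Σ(A ⊗ B) ⟶ ΣA ⊗ B` sends the summand of a simplex `(s, y)` of `Δ[1] × Δ[n]`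
to the same summand on the left factor, and by `B(y)` on the right factor. For resolutions all
structure maps of both sides are weak equivalences, so only degree zero matters. There the map is
the map of cofibers induced by the weak equivalence `A^1 ⊗ B^1 ⟶ A^1 ⊗ B^0` under two copies of
`A^0 ⊗ B^0`, and `weakEquivalence_cofiber` applies.
-/

noncomputable section

namespace CosimplicialResolutions

/-! ### Maps out of `X ⊗_Δ K` -/

section Tensor

variable {C : Type u} [Category.{v} C] [HasZeroMorphisms C] [HasColimitsOfSize.{0, 0} C]

open Classical in
/-- The inclusion of the copy of `Z` at `p` into `P · Z`; it is zero at the base point. -/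
def copowerι (P : Pointed.{0}) (Z : C) (p : P.X) : Z ⟶ (copower.obj P).obj Z :=
  dite (p = P.point) (fun _ ↦ 0)
    (fun h ↦ (Limits.Sigma.ι (fun _ : {p : P.X // p ≠ P.point} ↦ Z) ⟨p, h⟩ :))

lemma copowerι_of_ne {P : Pointed.{0}} (Z : C) {p : P.X} (h : p ≠ P.point) :
    copowerι P Z p = Limits.Sigma.ι (fun _ : {p : P.X // p ≠ P.point} ↦ Z) ⟨p, h⟩ :=
  dif_neg h

@[simp]
lemma copowerι_point (P : Pointed.{0}) (Z : C) : copowerι P Z P.point = 0 := dif_pos rfl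

lemma copowerι_map {P Q : Pointed.{0}} (f : P ⟶ Q) (Z : C) (p : P.X) :
    copowerι P Z p ≫ (copower.map f).app Z = copowerι Q Z (f.toFun p) := by
  by_cases h : p = P.point
  · subst h
    rw [copowerι_point, f.map_point, copowerι_point, zero_comp]
  · rw [copowerι_of_ne Z h]
    exact Sigma.ι_desc _ _

lemma copowerι_naturality (P : Pointed.{0}) {Y Z : C} (g : Y ⟶ Z) (p : P.X) :
    copowerι P Y p ≫ (copower.obj P).map g = g ≫ copowerι P Z p := by
  by_cases h : p = P.point
  · subst h
    simp
  · rw [copowerι_of_ne Y h, copowerι_of_ne Z h]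
    exact Sigma.ι_map (f := fun _ : {p : P.X // p ≠ P.point} ↦ Y) (fun _ ↦ g) _

lemma copower_hom_ext {P : Pointed.{0}} {Z T : C} {f g : (copower.obj P).obj Z ⟶ T}
    (h : ∀ p, copowerι P Z p ≫ f = copowerι P Z p ≫ g) : f = g := by
  refine Sigma.hom_ext _ _ fun p ↦ ?_
  have := h p.1
  rwa [copowerι_of_ne Z p.2] at this

/-- The map out of `P · Z` given by a family of maps indexed by `P`. -/
def copowerDesc {P : Pointed.{0}} {Z T : C} (h : P.X → (Z ⟶ T)) :
    (copower.obj P).obj Z ⟶ T :=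
  Limits.Sigma.desc fun p : {p : P.X // p ≠ P.point} ↦ h p.1

lemma copowerι_desc {P : Pointed.{0}} {Z T : C} (h : P.X → (Z ⟶ T)) (h0 : h P.point = 0)
    (p : P.X) : copowerι P Z p ≫ copowerDesc h = h p := by
  by_cases hp : p = P.point
  · subst hp
    simp [h0]
  · rw [copowerι_of_ne Z hp]
    exact Sigma.ι_desc _ _

/-- The map `K_k · X^k ⟶ X ⊗_Δ K` to the coend. -/
def toTensorDelta (X : SimplexCategory ⥤ C) (K : PSSet) (k : SimplexCategory) :
    (copower.obj (K.obj (op k))).obj (X.obj k) ⟶ (tensorDelta.obj X).obj K :=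
  coend.ι (coendIntegrand X K) k

/-- The map `X^k ⟶ X ⊗_Δ K` belonging to a `k`-simplex of `K`; it is zero at the base point. -/
def tensorι (X : SimplexCategory ⥤ C) (K : PSSet) (k : SimplexCategory) (x : (K.obj (op k)).X) :
    X.obj k ⟶ (tensorDelta.obj X).obj K :=
  copowerι (K.obj (op k)) (X.obj k) x ≫ toTensorDelta X K k

lemma tensorι_point (X : SimplexCategory ⥤ C) (K : PSSet) (k : SimplexCategory) :
    tensorι X K k (K.obj (op k)).point = 0 := by
  rw [tensorι, copowerι_point, zero_comp]

lemma tensorι_face (X : SimplexCategory ⥤ C) (K : PSSet) {k l : SimplexCategory} (f : k ⟶ l)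
    (x : (K.obj (op l)).X) :
    X.map f ≫ tensorι X K l x = tensorι X K k ((K.map f.op).toFun x) := by
  have h : (copower.map (K.map f.op)).app (X.obj k) ≫ toTensorDelta X K k =
      (copower.obj (K.obj (op l))).map (X.map f) ≫ toTensorDelta X K l :=
    coend.condition (coendIntegrand X K) f
  rw [tensorι, tensorι, ← copowerι_map, ← reassoc_of% copowerι_naturality, Category.assoc, h]

@[simp]
lemma tensorι_map (X : SimplexCategory ⥤ C) {K L : PSSet} (g : K ⟶ L) (k : SimplexCategory)
    (x : (K.obj (op k)).X) :
    tensorι X K k x ≫ (tensorDelta.obj X).map g = tensorι X L k ((g.app (op k)).toFun x) := by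
  have h : toTensorDelta X K k ≫ (tensorDelta.obj X).map g =
      (copower.map (g.app (op k))).app (X.obj k) ≫ toTensorDelta X L k := by
    have h' : ((coendIntegrandMap (𝟙 X) g).app (op k)).app k =
        (copower.map (g.app (op k))).app (X.obj k) := by
      simp [coendIntegrandMap, coendIntegrand]
    exact (coend.ι_map _ _).trans (congrArg (· ≫ toTensorDelta X L k) h')
  rw [tensorι, tensorι, Category.assoc, h, reassoc_of% copowerι_map]

@[simp]
lemma tensorι_app {X Y : SimplexCategory ⥤ C} (f : X ⟶ Y) (K : PSSet) (k : SimplexCategory)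
    (x : (K.obj (op k)).X) :
    tensorι X K k x ≫ (tensorDelta.map f).app K = f.app k ≫ tensorι Y K k x := by
  have h : toTensorDelta X K k ≫ (tensorDelta.map f).app K =
      (copower.obj (K.obj (op k))).map (f.app k) ≫ toTensorDelta Y K k := by
    have h' : ((coendIntegrandMap f (𝟙 K)).app (op k)).app k =
        (copower.obj (K.obj (op k))).map (f.app k) := by
      simp [coendIntegrandMap, coendIntegrand]
    exact (coend.ι_map _ _).trans (congrArg (· ≫ toTensorDelta Y K k) h')
  rw [tensorι, tensorι, Category.assoc, h, reassoc_of% copowerι_naturality]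

lemma tensor_hom_ext {X : SimplexCategory ⥤ C} {K : PSSet} {T : C}
    {f g : (tensorDelta.obj X).obj K ⟶ T}
    (h : ∀ k x, tensorι X K k x ≫ f = tensorι X K k x ≫ g) : f = g := by
  refine coend.hom_ext fun k ↦ copower_hom_ext fun x ↦ ?_
  have := h k x
  rw [tensorι, Category.assoc, Category.assoc] at this
  exact this

section Desc

variable {X : SimplexCategory ⥤ C} {K : PSSet} {T : C}
  (h : ∀ (k : SimplexCategory) (_ : (K.obj (op k)).X), X.obj k ⟶ T)
  (h0 : ∀ k, h k (K.obj (op k)).point = 0)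
  (hf : ∀ {k l : SimplexCategory} (f : k ⟶ l) (x : (K.obj (op l)).X),
    X.map f ≫ h l x = h k ((K.map f.op).toFun x))

/-- The map out of `X ⊗_Δ K` given by a natural family of maps indexed by the simplices of `K`
that vanishes at the base points. -/
def tensorDesc : (tensorDelta.obj X).obj K ⟶ T :=
  coend.desc (fun k ↦ copowerDesc (h k)) (by
    intro i j f
    refine copower_hom_ext fun x ↦ ?_
    have h1 : copowerι (K.obj (op j)) (X.obj i) x ≫
        (copower.map (K.map f.op)).app (X.obj i) ≫ copowerDesc (h i) =
        h i ((K.map f.op).toFun x) := by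
      rw [reassoc_of% copowerι_map, copowerι_desc _ (h0 i)]
    have h2 : copowerι (K.obj (op j)) (X.obj i) x ≫
        (copower.obj (K.obj (op j))).map (X.map f) ≫ copowerDesc (h j) =
        X.map f ≫ h j x := by
      rw [reassoc_of% copowerι_naturality, copowerι_desc _ (h0 j)]
    exact h1.trans ((hf f x).symm.trans h2.symm))

@[simp]
lemma tensorι_desc (k : SimplexCategory) (x : (K.obj (op k)).X) :
    tensorι X K k x ≫ tensorDesc h h0 hf = h k x := by
  have h1 : toTensorDelta X K k ≫ tensorDesc h h0 hf = copowerDesc (h k) := coend.ι_desc _ _ _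
  rw [tensorι, Category.assoc, h1, copowerι_desc (h k) (h0 k) x]

end Desc

end Tensor

/-! ### Extending natural families of maps -/

section Families

variable {E : Type} [SmallCategory E] {C : Type u} [Category.{v} C] (X : E ⥤ C)

/-- A cocone with vertex `Z` on the restriction of `X` to the full subcategory of the objects
satisfying `F`. -/
structure Family (F : ObjectProperty E) (Z : C) where
  /-- the members of the family -/
  hom (e : E) (he : F e) : X.obj e ⟶ Z
  comm {e e' : E} (f : e ⟶ e') (he : F e) (he' : F e') : X.map f ≫ hom e' he' = hom e he

/-- The objects satisfying `F` are closed under passing to the source of a morphism. -/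
def IsLower (F : ObjectProperty E) : Prop := ∀ ⦃e e' : E⦄ (_ : e ⟶ e'), F e' → F e

/-- Families on `F` with values in the source of `p` extend to `G`, with a prescribed composition
with `p`. When the colimits exist, this says that `colim_F X ⟶ colim_G X` has the left lifting
property with respect to `p`. -/
def HasExtension (F G : ObjectProperty E) {Z W : C} (p : Z ⟶ W) : Prop :=
  ∀ (k : Family X F Z) (l : Family X G W),
    (∀ e he he', k.hom e he ≫ p = l.hom e he') →
    ∃ k' : Family X G Z, (∀ e he he', k'.hom e he' = k.hom e he) ∧
      ∀ e he, k'.hom e he ≫ p = l.hom e he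

variable {X}

/-- The restriction of a family to a smaller class of objects. -/
@[simps]
def Family.restrict {F G : ObjectProperty E} {Z : C} (k : Family X G Z) (h : F ≤ G) :
    Family X F Z where
  hom e he := k.hom e (h e he)
  comm f _ _ := k.comm f _ _

/-- The family of all maps `X e ⟶ Z` induced by a map from the value of `X` at a terminal
object. -/
def Family.ofTerminal {t : E} (ht : IsTerminal t) (F : ObjectProperty E) {Z : C}
    (g : X.obj t ⟶ Z) : Family X F Z where
  hom e _ := X.map (ht.from e) ≫ g
  comm f _ _ := by rw [← Functor.map_comp_assoc, ht.comp_from]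

lemma HasExtension.trans {F G H : ObjectProperty E} {Z W : C} {p : Z ⟶ W}
    (h₁ : HasExtension X F G p) (h₂ : HasExtension X G H p) (hFG : F ≤ G) (hGH : G ≤ H) :
    HasExtension X F H p := by
  intro k l hkl
  obtain ⟨k', hk', hl'⟩ := h₁ k (l.restrict hGH) (fun e he he' ↦ hkl e he _)
  obtain ⟨k'', hk'', hl''⟩ := h₂ k' l (fun e he he' ↦ hl' e he)
  exact ⟨k'', fun e he he' ↦ (hk'' e (hFG e he) he').trans (hk' e he _), hl''⟩

lemma HasExtension.refl (F : ObjectProperty E) {Z W : C} (p : Z ⟶ W) :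
    HasExtension X F F p :=
  fun k _ h ↦ ⟨k, fun _ _ _ ↦ rfl, fun e he ↦ h e he he⟩

variable (X) in
/-- The lifting problem for the object `e` alone: a family on `F` with values in the source of `p`
extends over `e`, with a prescribed composition with `p`. -/
def CellLift (F : ObjectProperty E) (e : E) {Z W : C} (p : Z ⟶ W) : Prop :=
  ∀ (k : Family X F Z) (g : X.obj e ⟶ W),
    (∀ e' (u : e' ⟶ e) (he' : F e'), X.map u ≫ g = k.hom e' he' ≫ p) →
    ∃ d : X.obj e ⟶ Z, (∀ e' (u : e' ⟶ e) (he' : F e'), X.map u ≫ d = k.hom e' he') ∧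
      d ≫ p = g

/-- Families extend over a cell: since each object has at most one map to `e`, a solution of the
lifting problem at `e` determines the values on everything that maps to `e`. -/
lemma CellLift.hasExtension {F G : ObjectProperty E} (hF : IsLower F) {e : E}
    (he : ∀ e', Subsingleton (e' ⟶ e)) {Z W : C} {p : Z ⟶ W} (h : CellLift X F e p)
    (hFG : F ≤ G) (hGe : G e) (hG : ∀ e', G e' → F e' ∨ Nonempty (e' ⟶ e)) :
    HasExtension X F G p := by
  classical
  intro k l hkl
  obtain ⟨d, hd, hd'⟩ := h k (l.hom e hGe) (fun e' u he' ↦ by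
    rw [hkl e' he' (hFG e' he'), l.comm u])
  refine ⟨{ hom := fun e' he' ↦ if h : F e' then k.hom e' h else
                X.map ((hG e' he').resolve_left h).some ≫ d
            comm := ?_ }, fun e' he' _ ↦ dif_pos he', fun e' he' ↦ ?_⟩
  · intro e' e'' f he' he''
    by_cases h'' : F e''
    · rw [dif_pos h'', dif_pos (hF f h''), k.comm f]
    · rw [dif_neg h'', ← Functor.map_comp_assoc]
      by_cases h' : F e'
      · rw [dif_pos h', hd]
      · rw [dif_neg h']
        congr 2
        exact (he e').elim _ _
  · dsimp only
    split_ifs with h'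
    · exact hkl _ _ _
    · rw [Category.assoc, hd', l.comm]

/-- Families extend from `F` to everything if cells can be attached until nothing is left. The
function `r` bounds the number of cells. -/
theorem hasExtension_top {ι : Type*} [Finite ι] (r : E → ι) {Z W : C} {p : Z ⟶ W}
    {F : ObjectProperty E} (hF : IsLower F)
    (H : ∀ F' : ObjectProperty E, IsLower F' → F ≤ F' → (∃ e, ¬ F' e) →
      ∃ e, ¬ F' e ∧ (∀ e', Subsingleton (e' ⟶ e)) ∧ (∀ e', r e' = r e → Nonempty (e' ⟶ e)) ∧
        CellLift X F' e p) :
    HasExtension X F ⊤ p := by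
  induction hn : Set.ncard {i | ∃ e, ¬ F e ∧ r e = i} using Nat.strong_induction_on
    generalizing F with
  | _ n ih =>
    by_cases hex : ∃ e, ¬ F e
    · obtain ⟨e, he, hthin, hr, hlift⟩ := H F hF le_rfl hex
      let G : ObjectProperty E := fun e' ↦ F e' ∨ Nonempty (e' ⟶ e)
      have hFG : F ≤ G := fun e' h ↦ Or.inl h
      have hG : IsLower G := by
        rintro e' e'' f (h | ⟨⟨u⟩⟩)
        · exact Or.inl (hF f h)
        · exact Or.inr ⟨f ≫ u⟩
      refine (hlift.hasExtension hF hthin hFG (Or.inr ⟨𝟙 e⟩) (fun _ h ↦ h)).trans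
        (ih _ ?_ hG (fun F' h₁ h₂ ↦ H F' h₁ (hFG.trans h₂)) rfl) hFG le_top
      rw [← hn]
      apply Set.ncard_lt_ncard _ (Set.toFinite _)
      refine ⟨fun i ⟨e', h, h'⟩ ↦ ⟨e', fun h'' ↦ h (hFG e' h''), h'⟩, fun hle ↦ ?_⟩
      obtain ⟨e', h, h'⟩ := hle ⟨e, he, rfl⟩
      exact h (Or.inr (hr e' h'))
    · obtain rfl : F = ⊤ := by
        ext e
        simp only [not_exists, not_not] at hex
        exact ⟨fun _ ↦ trivial, fun _ ↦ hex e⟩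
      exact .refl _ _

end Families

/-! ### Chains in partially ordered sets -/

/-- A simplex of the nerve of a partially ordered set `Q`. These are the objects of the category
of elements of the nerve. -/
structure Chain (Q : Type) [PartialOrder Q] where
  /-- the dimension -/
  dim : SimplexCategory
  /-- the sequence of vertices -/
  vert : Fin (dim.len + 1) →o Q

namespace Chain

variable {Q : Type} [PartialOrder Q]

/-- Morphisms of simplices of the nerve. -/
@[ext]
structure Hom (e e' : Chain Q) where
  /-- the underlying simplicial operator -/
  mor : e.dim ⟶ e'.dim
  fac : ∀ i, e'.vert (mor.toOrderHom i) = e.vert i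

instance : SmallCategory (Chain Q) where
  Hom := Hom
  id e := ⟨𝟙 _, fun _ ↦ rfl⟩
  comp f g := ⟨f.mor ≫ g.mor, fun i ↦ (g.fac _).trans (f.fac i)⟩

/-- A cosimplicial object `A`, as the functor `e ↦ A^(dim e)` on the simplices of a nerve. -/
abbrev functor {C : Type*} [Category* C] (A : SimplexCategory ⥤ C) (Q : Type) [PartialOrder Q] :
    Chain Q ⥤ C where
  obj e := A.obj e.dim
  map f := A.map f.mor
  map_id _ := A.map_id _
  map_comp _ _ := A.map_comp _ _

/-- The face or degeneracy of a simplex along a simplicial operator. -/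
abbrev pull (e : Chain Q) {m : SimplexCategory} (f : m ⟶ e.dim) : Chain Q where
  dim := m
  vert := e.vert.comp f.toOrderHom

/-- The canonical map from `e.pull f` to `e`. -/
def pullHom (e : Chain Q) {m : SimplexCategory} (f : m ⟶ e.dim) : e.pull f ⟶ e :=
  ⟨f, fun _ ↦ rfl⟩

/-- A simplex is nondegenerate if its vertices are distinct. -/
def Nondegenerate (e : Chain Q) : Prop := Function.Injective e.vert

/-- The set of vertices of a simplex. -/
def range (e : Chain Q) : Set Q := Set.range e.vert

lemma range_subset {e e' : Chain Q} (f : e ⟶ e') : e.range ⊆ e'.range := by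
  rintro _ ⟨i, rfl⟩
  exact ⟨f.mor.toOrderHom i, f.fac i⟩

lemma Nondegenerate.subsingleton {e : Chain Q} (he : e.Nondegenerate) (e' : Chain Q) :
    Subsingleton (e' ⟶ e) where
  allEq f g := by
    apply Hom.ext
    ext i : 3
    exact he ((f.fac i).trans (g.fac i).symm)

lemma Nondegenerate.nonempty_hom {e : Chain Q} (he : e.Nondegenerate) {e' : Chain Q}
    (h : e'.range ⊆ e.range) : Nonempty (e' ⟶ e) := by
  choose f hf using fun i ↦ h ⟨i, rfl⟩
  refine ⟨⟨SimplexCategory.Hom.mk ⟨f, fun i j hij ↦ ?_⟩, hf⟩⟩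
  by_contra hlt
  have h₁ : e.vert (f j) ≤ e.vert (f i) := e.vert.monotone (not_le.1 hlt).le
  rw [hf, hf] at h₁
  have h₂ := he ((hf i).trans ((le_antisymm (e'.vert.monotone hij) h₁).trans (hf j).symm))
  exact hlt h₂.le

lemma card_eq {α : Type*} {T : Finset α} (hT : T.Nonempty) : T.card = T.card - 1 + 1 := by
  have := hT.card_pos
  omega

/-- The injective simplicial operator with image `T`. -/
def faceHom {m : SimplexCategory} (T : Finset (Fin (m.len + 1))) (hT : T.Nonempty) :
    ⦋T.card - 1⦌ ⟶ m :=
  SimplexCategory.Hom.mk (T.orderEmbOfFin (card_eq hT)).toOrderHom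

lemma range_faceHom {m : SimplexCategory} (T : Finset (Fin (m.len + 1))) (hT : T.Nonempty) :
    Set.range (faceHom T hT).toOrderHom = T :=
  Finset.range_orderEmbOfFin T (card_eq hT)

lemma faceHom_injective {m : SimplexCategory} (T : Finset (Fin (m.len + 1))) (hT : T.Nonempty) :
    Function.Injective (faceHom T hT).toOrderHom :=
  (T.orderEmbOfFin (card_eq hT)).injective

/-- A degenerate simplex factors through a simplex of smaller dimension that is a face of it. -/
lemma exists_of_not_nondegenerate {e : Chain Q} (he : ¬ e.Nondegenerate) :
    ∃ e' : Chain Q, e'.dim.len < e.dim.len ∧ Nonempty (e ⟶ e') ∧ Nonempty (e' ⟶ e) := by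
  classical
  -- the vertices at which the chain takes a value for the first time
  let T : Finset (Fin (e.dim.len + 1)) := {a | ∀ b, e.vert b = e.vert a → a ≤ b}
  have hT : T.Nonempty := ⟨0, by simp [T]⟩
  have hlt : T.card < e.dim.len + 1 := by
    have : T ⊂ Finset.univ := by
      rw [Finset.ssubset_univ_iff]
      intro h
      apply he
      intro a b hab
      have ha : a ∈ T := by simp [h]
      have hb : b ∈ T := by simp [h]
      simp only [T, Finset.mem_filter, Finset.mem_univ, true_and] at ha hb
      exact le_antisymm (ha b hab.symm) (hb a hab)
    simpa using! Finset.card_lt_card this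
  have hpos := hT.card_pos
  have mem : ∀ i, (faceHom T hT).toOrderHom i ∈ T := fun i ↦ by
    have : (faceHom T hT).toOrderHom i ∈ (T : Set _) := by
      rw [← range_faceHom T hT]; exact ⟨i, rfl⟩
    exact this
  have hnd : (e.pull (faceHom T hT)).Nondegenerate := by
    intro i j hij
    apply faceHom_injective T hT
    have hi := mem i
    have hj := mem j
    simp only [T, Finset.mem_filter, Finset.mem_univ, true_and] at hi hj
    exact le_antisymm (hi _ hij.symm) (hj _ hij)
  refine ⟨e.pull (faceHom T hT), ?_, hnd.nonempty_hom ?_, ⟨e.pullHom _⟩⟩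
  · change T.card - 1 < e.dim.len
    omega
  · rintro _ ⟨i, rfl⟩
    have hne : (Finset.univ.filter (fun b ↦ e.vert b = e.vert i)).Nonempty := ⟨i, by simp⟩
    have h₁ := Finset.min'_mem _ hne
    have h₂ : Finset.min' _ hne ∈ (T : Set _) := by
      simp only [Finset.mem_filter, Finset.mem_univ, true_and] at h₁
      simp only [T, Finset.coe_filter, Finset.mem_univ, true_and, Set.mem_ofPred_eq]
      intro b hb
      exact Finset.min'_le _ _ (by simpa using hb.trans h₁)
    rw [← range_faceHom T hT] at h₂
    obtain ⟨j, hj⟩ := h₂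
    refine ⟨j, ?_⟩
    simp only [Finset.mem_filter, Finset.mem_univ, true_and] at h₁
    exact (congrArg e.vert hj).trans h₁

/-- A map that is not surjective factors through a proper face. -/
lemma exists_of_not_surjective {e' e : Chain Q} (f : e' ⟶ e)
    (hf : ¬ Function.Surjective f.mor.toOrderHom) :
    ∃ e'' : Chain Q, e''.dim.len < e.dim.len ∧ Nonempty (e' ⟶ e'') ∧ Nonempty (e'' ⟶ e) := by
  classical
  obtain ⟨b, hb⟩ := not_forall.1 hf
  let T : Finset (Fin (e.dim.len + 1)) := Finset.univ.image f.mor.toOrderHom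
  have hT : T.Nonempty := ⟨f.mor.toOrderHom 0, by simp [T]⟩
  have hlt : T.card < e.dim.len + 1 := by
    have : T ⊂ Finset.univ := by
      rw [Finset.ssubset_univ_iff]
      intro h
      have : b ∈ T := by simp [h]
      simp only [T, Finset.mem_image, Finset.mem_univ, true_and] at this
      exact hb this
    simpa using! Finset.card_lt_card this
  have hpos := hT.card_pos
  have hmem : ∀ i, ∃ j, (faceHom T hT).toOrderHom j = f.mor.toOrderHom i := fun i ↦ by
    have : f.mor.toOrderHom i ∈ (T : Set _) := by simp [T]
    rwa [← range_faceHom T hT] at this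
  choose g hg using hmem
  refine ⟨e.pull (faceHom T hT), ?_, ⟨⟨SimplexCategory.Hom.mk ⟨g, fun i j hij ↦ ?_⟩, fun i ↦ ?_⟩⟩,
    ⟨e.pullHom _⟩⟩
  · change T.card - 1 < e.dim.len
    omega
  · refine (T.orderEmbOfFin (card_eq hT)).le_iff_le.1 ?_
    change (faceHom T hT).toOrderHom (g i) ≤ (faceHom T hT).toOrderHom (g j)
    exact ((hg i).trans_le (f.mor.toOrderHom.monotone hij)).trans_eq (hg j).symm
  · exact (congrArg e.vert (hg i)).trans (f.fac i)

lemma nonempty_hom_of_surjective {e' e : Chain Q} (f : e' ⟶ e)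
    (hf : Function.Surjective f.mor.toOrderHom) : Nonempty (e ⟶ e') := by
  have : Epi f.mor := SimplexCategory.epi_iff_surjective.2 hf
  have := isSplitEpi_of_epi f.mor
  refine ⟨⟨section_ f.mor, fun i ↦ ?_⟩⟩
  rw [← f.fac]
  have := congrArg (fun g ↦ e.vert (g.toOrderHom i)) (IsSplitEpi.id f.mor)
  exact this

/-- If a lower class of simplices is not everything, some nondegenerate simplex is outside while
its whole boundary is inside. -/
lemma exists_minimal {F : ObjectProperty (Chain Q)} (hF : IsLower F) (h : ∃ e, ¬ F e) :
    ∃ e : Chain Q, ¬ F e ∧ e.Nondegenerate ∧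
      ∀ e' (u : e' ⟶ e), F e' ↔ ¬ Function.Surjective u.mor.toOrderHom := by
  obtain ⟨e, he, hmin⟩ := exists_minimalFor_of_wellFoundedLT (fun e ↦ ¬ F e)
    (fun e : Chain Q ↦ e.dim.len) h
  have hmin' : ∀ e' : Chain Q, e'.dim.len < e.dim.len → F e' := fun e' h' ↦ by
    by_contra h''
    exact absurd (hmin h'' h'.le) (not_le.2 h')
  refine ⟨e, he, ?_, fun e' u ↦ ⟨fun h' hu ↦ ?_, fun hu ↦ ?_⟩⟩
  · by_contra hnd
    obtain ⟨e', h₁, ⟨f⟩, -⟩ := exists_of_not_nondegenerate hnd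
    exact he (hF f (hmin' e' h₁))
  · obtain ⟨f⟩ := nonempty_hom_of_surjective u hu
    exact he (hF f h')
  · obtain ⟨e'', h₁, ⟨f⟩, -⟩ := exists_of_not_surjective u hu
    exact hF f (hmin' e'' h₁)

/-- The analogue of `exists_minimal` for pairs of simplices. -/
lemma exists_minimal_prod {Q' : Type} [PartialOrder Q']
    {F : ObjectProperty (Chain Q × Chain Q')} (hF : IsLower F) (h : ∃ e, ¬ F e) :
    ∃ e : Chain Q × Chain Q', ¬ F e ∧ e.1.Nondegenerate ∧ e.2.Nondegenerate ∧
      ∀ e' (u : e' ⟶ e), F e' ↔ ¬ (Function.Surjective u.1.mor.toOrderHom ∧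
        Function.Surjective u.2.mor.toOrderHom) := by
  obtain ⟨⟨e₁, e₂⟩, he, hmin⟩ := exists_minimalFor_of_wellFoundedLT (fun e ↦ ¬ F e)
    (fun e : Chain Q × Chain Q' ↦ e.1.dim.len + e.2.dim.len) h
  have hmin' : ∀ (e₁' : Chain Q) (e₂' : Chain Q'),
      e₁'.dim.len + e₂'.dim.len < e₁.dim.len + e₂.dim.len → F (e₁', e₂') := fun e₁' e₂' h' ↦ by
    by_contra h''
    exact absurd (hmin h'' h'.le) (not_le.2 h')
  refine ⟨(e₁, e₂), he, ?_, ?_, fun ⟨e₁', e₂'⟩ ⟨u₁, u₂⟩ ↦ ⟨fun h' ⟨hu₁, hu₂⟩ ↦ ?_, fun hu ↦ ?_⟩⟩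
  · by_contra hnd
    obtain ⟨e', h₁, ⟨f⟩, -⟩ := exists_of_not_nondegenerate hnd
    exact he (hF (show (e₁, e₂) ⟶ (e', e₂) from (f, 𝟙 _))
      (hmin' e' e₂ (by dsimp only at h₁; omega)))
  · by_contra hnd
    obtain ⟨e', h₁, ⟨f⟩, -⟩ := exists_of_not_nondegenerate hnd
    exact he (hF (show (e₁, e₂) ⟶ (e₁, e') from (𝟙 _, f))
      (hmin' e₁ e' (by dsimp only at h₁; omega)))
  · obtain ⟨f₁⟩ := nonempty_hom_of_surjective u₁ hu₁
    obtain ⟨f₂⟩ := nonempty_hom_of_surjective u₂ hu₂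
    exact he (hF (show (e₁, e₂) ⟶ (e₁', e₂') from (f₁, f₂)) h')
  · rcases not_and_or.1 hu with hu | hu
    · obtain ⟨e'', h₁, ⟨f⟩, -⟩ := exists_of_not_surjective u₁ hu
      exact hF (show (e₁', e₂') ⟶ (e'', e₂) from (f, u₂))
        (hmin' e'' e₂ (by dsimp only at h₁; omega))
    · obtain ⟨e'', h₁, ⟨f⟩, -⟩ := exists_of_not_surjective u₂ hu
      exact hF (show (e₁', e₂') ⟶ (e₁, e'') from (u₁, f))
        (hmin' e₁ e'' (by dsimp only at h₁; omega))

end Chain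

/-! ### Lifting properties of maps between colimits of families -/

section Lifting

variable {C : Type u} [Category.{v} C]

lemma hasLiftingProperty_of_exists {A B Z W : C} {i : A ⟶ B} {p : Z ⟶ W}
    (h : ∀ (a : A ⟶ Z) (b : B ⟶ W), a ≫ p = i ≫ b → ∃ d : B ⟶ Z, i ≫ d = a ∧ d ≫ p = b) :
    HasLiftingProperty i p where
  sq_hasLift {a b} sq := by
    obtain ⟨d, h₁, h₂⟩ := h a b sq.w
    exact ⟨⟨d, h₁, h₂⟩⟩

lemma exists_lift {A B Z W : C} (i : A ⟶ B) (p : Z ⟶ W) [HasLiftingProperty i p]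
    {a : A ⟶ Z} {b : B ⟶ W} (h : a ≫ p = i ≫ b) : ∃ d : B ⟶ Z, i ≫ d = a ∧ d ≫ p = b :=
  have sq : CommSq a i p b := ⟨h⟩
  ⟨sq.lift, sq.fac_left, sq.fac_right⟩

lemma cofibration_of_hasLiftingProperty [ModelCategory C] {A B : C} {i : A ⟶ B}
    (h : ∀ {Z W : C} (p : Z ⟶ W) [Fibration p] [WeakEquivalence p], HasLiftingProperty i p) :
    Cofibration i := by
  rw [cofibration_iff, ← trivialFibrations_llp]
  intro Z W p hp
  obtain ⟨_, _⟩ := (mem_trivialFibrations_iff p).1 hp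
  exact h p

lemma trivialCofibration_of_hasLiftingProperty [ModelCategory C] {A B : C} {i : A ⟶ B}
    (h : ∀ {Z W : C} (p : Z ⟶ W) [Fibration p], HasLiftingProperty i p) :
    Cofibration i ∧ WeakEquivalence i := by
  rw [← mem_trivialCofibrations_iff, ← fibrations_llp]
  intro Z W p hp
  have := (fibration_iff p).2 hp
  exact h p

end Lifting

section FamilyColimit

variable {E : Type} [SmallCategory E] {C : Type u} [Category.{v} C]
  [HasColimitsOfSize.{0, 0} C] (X : E ⥤ C) (F : ObjectProperty E)

/-- The colimit of `X` over the objects satisfying `F`. -/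
def familyColimit : C := colimit (F.ι ⋙ X)

/-- The canonical maps to the colimit of `X` over the objects satisfying `F`. -/
def familyColimit.ι : Family X F (familyColimit X F) where
  hom e he := colimit.ι (F.ι ⋙ X) ⟨e, he⟩
  comm {e e'} f he he' := colimit.w (F.ι ⋙ X)
    (show (⟨e, he⟩ : F.FullSubcategory) ⟶ ⟨e', he'⟩ from ⟨f⟩)

variable {X F}

/-- A family, as a cocone. -/
def Family.cocone {Z : C} (k : Family X F Z) : Cocone (F.ι ⋙ X) where
  pt := Z
  ι := { app e := k.hom e.1 e.2
         naturality e e' f := (k.comm f.hom e.2 e'.2).trans (Category.comp_id _).symm }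

/-- The map out of the colimit given by a family. -/
def Family.desc {Z : C} (k : Family X F Z) : familyColimit X F ⟶ Z :=
  colimit.desc (F.ι ⋙ X) k.cocone

@[simp]
lemma Family.ι_desc {Z : C} (k : Family X F Z) (e : E) (he : F e) :
    (familyColimit.ι X F).hom e he ≫ k.desc = k.hom e he :=
  colimit.ι_desc _ _

lemma familyColimit.hom_ext {Z : C} {f g : familyColimit X F ⟶ Z}
    (h : ∀ e he, (familyColimit.ι X F).hom e he ≫ f = (familyColimit.ι X F).hom e he ≫ g) :
    f = g :=
  colimit.hom_ext fun e ↦ h e.1 e.2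

/-- The composition of a family with a map. -/
@[simps]
def Family.comp {Z W : C} (k : Family X F Z) (g : Z ⟶ W) : Family X F W where
  hom e he := k.hom e he ≫ g
  comm f he he' := by rw [← Category.assoc, k.comm]

section

variable {D : Type*} [Category* D] (G : C ⥤ D) [PreservesColimitsOfSize.{0, 0} G]

lemma familyColimit.map_hom_ext {Z : D} {f g : G.obj (familyColimit X F) ⟶ Z}
    (h : ∀ e he, G.map ((familyColimit.ι X F).hom e he) ≫ f =
      G.map ((familyColimit.ι X F).hom e he) ≫ g) : f = g :=
  (isColimitOfPreserves G (colimit.isColimit (F.ι ⋙ X))).hom_ext fun e ↦ h e.1 e.2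

lemma Family.exists_desc_map {Z : D} (k : Family (X ⋙ G) F Z) :
    ∃ f : G.obj (familyColimit X F) ⟶ Z,
      ∀ e he, G.map ((familyColimit.ι X F).hom e he) ≫ f = k.hom e he := by
  let c : Cocone ((F.ι ⋙ X) ⋙ G) :=
    { pt := Z
      ι := { app e := k.hom e.1 e.2
             naturality e e' f := (k.comm f.hom e.2 e'.2).trans (Category.comp_id _).symm } }
  exact ⟨(isColimitOfPreserves G (colimit.isColimit (F.ι ⋙ X))).desc c,
    fun e he ↦ (isColimitOfPreserves G (colimit.isColimit (F.ι ⋙ X))).fac c ⟨e, he⟩⟩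

end

/-- An extension property of families is a lifting property of the map of colimits. -/
lemma HasExtension.hasLiftingProperty {G : ObjectProperty E} (hFG : F ≤ G) {Z W : C}
    {p : Z ⟶ W} (h : HasExtension X F G p) :
    HasLiftingProperty ((familyColimit.ι X G).restrict hFG).desc p := by
  refine hasLiftingProperty_of_exists fun a b hab ↦ ?_
  obtain ⟨k', h₁, h₂⟩ := h ((familyColimit.ι X F).comp a) ((familyColimit.ι X G).comp b)
    (fun e he he' ↦ by
      rw [Family.comp_hom, Category.assoc, hab, reassoc_of% Family.ι_desc]
      rfl)
  refine ⟨k'.desc, familyColimit.hom_ext fun e he ↦ ?_, familyColimit.hom_ext fun e he ↦ ?_⟩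
  · rw [reassoc_of% Family.ι_desc, Family.restrict_hom, Family.ι_desc, h₁ e he]
    rfl
  · rw [reassoc_of% Family.ι_desc, h₂]
    rfl

end FamilyColimit

/-! ### Reedy cofibrant cosimplicial objects -/

namespace Chain

/-- The nondegenerate simplex of the nerve of `[n]` of dimension `n`. -/
abbrev top (n : ℕ) : Chain (Fin (n + 1)) where
  dim := ⦋n⦌
  vert := OrderHom.id

/-- A simplex of the nerve of `[n]` as a simplicial operator. -/
abbrev toMor {n : ℕ} (e : Chain (Fin (n + 1))) : e.dim ⟶ ⦋n⦌ := SimplexCategory.Hom.mk e.vert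

/-- A simplicial operator as a simplex of the nerve of `[n]`. -/
abbrev ofMor {n : ℕ} {m : SimplexCategory} (f : m ⟶ ⦋n⦌) : Chain (Fin (n + 1)) where
  dim := m
  vert := f.toOrderHom

lemma mor_toMor {n : ℕ} {e e' : Chain (Fin (n + 1))} (f : e ⟶ e') :
    f.mor ≫ e'.toMor = e.toMor := by
  ext i : 3
  exact f.fac i

lemma mor_eq_toMor {n : ℕ} {e : Chain (Fin (n + 1))} (f : e ⟶ top n) : f.mor = e.toMor := by
  ext i : 3
  exact f.fac i

/-- The simplex `top n` is a terminal object. -/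
def isTerminalTop (n : ℕ) : IsTerminal (top n) :=
  IsTerminal.ofUniqueHom (fun e ↦ ⟨e.toMor, fun _ ↦ rfl⟩) (fun e f ↦ by
    apply Hom.ext
    ext i : 3
    exact f.fac i)

/-- The boundary of the standard simplex. -/
def boundary (n : ℕ) : ObjectProperty (Chain (Fin (n + 1))) :=
  fun e ↦ ¬ Function.Surjective e.vert

/-- The simplices of the nerve of `Q` obtained from `e` by simplicial operators. -/
abbrev overFunctor {Q : Type} [PartialOrder Q] (e : Chain Q) :
    Chain (Fin (e.dim.len + 1)) ⥤ Chain Q where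
  obj x := ⟨x.dim, e.vert.comp x.vert⟩
  map f := ⟨f.mor, fun i ↦ congrArg e.vert (f.fac i)⟩

/-- The canonical map from a simplex in the image of `overFunctor e` to `e`. -/
abbrev overHom {Q : Type} [PartialOrder Q] (e : Chain Q) (x : Chain (Fin (e.dim.len + 1))) :
    e.overFunctor.obj x ⟶ e where
  mor := x.toMor
  fac _ := rfl

end Chain

section BoundaryLift

variable {C : Type u} [Category.{v} C]

/-- The lifting property of the latching map of `A` in degree `n`, in terms of families. -/
def BoundaryLift (A : SimplexCategory ⥤ C) (n : ℕ) {Z W : C} (p : Z ⟶ W) : Prop :=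
  CellLift (Chain.functor A (Fin (n + 1))) (Chain.boundary n) (Chain.top n) p

/-- Families on all of the boundary of a simplex of a nerve extend over the simplex. -/
lemma BoundaryLift.cellLift {Q : Type} [PartialOrder Q] {A : SimplexCategory ⥤ C}
    {e : Chain Q} {Z W : C} {p : Z ⟶ W} (h : BoundaryLift A e.dim.len p)
    {F : ObjectProperty (Chain Q)}
    (hF : ∀ e' (u : e' ⟶ e), F e' ↔ ¬ Function.Surjective u.mor.toOrderHom) :
    CellLift (Chain.functor A Q) F e p := by
  intro k g hg
  obtain ⟨d, hd₁, hd₂⟩ := h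
    { hom := fun x hx ↦ k.hom (e.overFunctor.obj x) ((hF _ (e.overHom x)).2 hx)
      comm := fun f _ _ ↦ k.comm (e.overFunctor.map f) _ _ } g
    (fun x u hx ↦ hg (e.overFunctor.obj x) ⟨u.mor, fun i ↦ congrArg e.vert (u.fac i)⟩ _)
  refine ⟨d, fun e' u he' ↦ ?_, hd₂⟩
  have h₁ := hd₁ ⟨e'.dim, u.mor.toOrderHom⟩ ⟨u.mor, fun _ ↦ rfl⟩ ((hF _ u).1 he')
  have h₂ := k.comm (e := e') (e' := e.overFunctor.obj ⟨e'.dim, u.mor.toOrderHom⟩)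
    ⟨𝟙 _, fun i ↦ u.fac i⟩ he' ((hF _ (e.overHom _)).2 ((hF _ u).1 he'))
  rw [← h₂]
  refine h₁.trans ?_
  symm
  exact (congrArg (· ≫ _) (A.map_id _)).trans (Category.id_comp _)

end BoundaryLift

section Tensor

variable {C : Type u} [Category.{v} C] [HasZeroMorphisms C] [HasColimitsOfSize.{0, 0} C]

/-- The map `X^k ⟶ X ⊗_Δ K₊` belonging to a `k`-simplex of `K`. -/
def plusι (X : SimplexCategory ⥤ C) (K : SSet.{0}) (k : SimplexCategory) (x : K.obj (op k)) :
    X.obj k ⟶ (tensorDelta.obj X).obj (plus.obj K) :=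
  tensorι X (plus.obj K) k (some x)

lemma plusι_face (X : SimplexCategory ⥤ C) (K : SSet.{0}) {k l : SimplexCategory} (f : k ⟶ l)
    (x : K.obj (op l)) : X.map f ≫ plusι X K l x = plusι X K k (K.map f.op x) :=
  tensorι_face X (plus.obj K) f (some x)

lemma plusι_map (X : SimplexCategory ⥤ C) {K L : SSet.{0}} (g : K ⟶ L) (k : SimplexCategory)
    (x : K.obj (op k)) :
    plusι X K k x ≫ (tensorDelta.obj X).map (plus.map g) = plusι X L k (g.app (op k) x) :=
  tensorι_map X (plus.map g) k (some x)

lemma plus_hom_ext {X : SimplexCategory ⥤ C} {K : SSet.{0}} {T : C}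
    {f g : (tensorDelta.obj X).obj (plus.obj K) ⟶ T}
    (h : ∀ k x, plusι X K k x ≫ f = plusι X K k x ≫ g) : f = g := by
  refine tensor_hom_ext fun k x ↦ ?_
  rcases x with _ | x
  · have := tensorι_point X (plus.obj K) k
    change tensorι X (plus.obj K) k none = 0 at this
    rw [this, zero_comp, zero_comp]
  · exact h k x

lemma exists_plus_desc {X : SimplexCategory ⥤ C} {K : SSet.{0}} {T : C}
    (h : ∀ (k : SimplexCategory) (_ : K.obj (op k)), X.obj k ⟶ T)
    (hf : ∀ {k l : SimplexCategory} (f : k ⟶ l) (x : K.obj (op l)),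
      X.map f ≫ h l x = h k (K.map f.op x)) :
    ∃ g : (tensorDelta.obj X).obj (plus.obj K) ⟶ T, ∀ k x, plusι X K k x ≫ g = h k x := by
  refine ⟨tensorDesc (fun k (x : Option _) ↦ x.elim 0 (h k)) (fun _ ↦ rfl) ?_, fun k x ↦ ?_⟩
  · intro k l f x
    rcases x with _ | x
    · exact comp_zero
    · exact hf f x
  · exact tensorι_desc (K := plus.obj K) _ _ _ k (some x)

/-- The canonical map `X^m ⟶ X ⊗_Δ Δ[n]₊` belonging to an `m`-simplex of `Δ[n]`. -/
def stdι (X : SimplexCategory ⥤ C) {n : ℕ} (e : Chain (Fin (n + 1))) :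
    X.obj e.dim ⟶ (tensorDelta.obj X).obj (plus.obj Δ[n]) :=
  plusι X Δ[n] e.dim (SSet.stdSimplex.objEquiv.symm e.toMor)

lemma stdι_face (X : SimplexCategory ⥤ C) {n : ℕ} {e e' : Chain (Fin (n + 1))} (f : e ⟶ e') :
    X.map f.mor ≫ stdι X e' = stdι X e :=
  (plusι_face _ _ _ _).trans (congrArg (fun t ↦ plusι X Δ[n] e.dim
    (SSet.stdSimplex.objEquiv.symm t)) (Chain.mor_toMor f))

lemma stdι_eq (X : SimplexCategory ⥤ C) {n : ℕ} (e : Chain (Fin (n + 1))) :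
    X.map e.toMor ≫ stdι X (Chain.top n) = stdι X e :=
  stdι_face X ((Chain.isTerminalTop n).from e)

/-- The canonical family of maps to `X ⊗_Δ ∂Δ[n]₊`. -/
def boundaryFamily (X : SimplexCategory ⥤ C) (n : ℕ) :
    Family (Chain.functor X (Fin (n + 1))) (Chain.boundary n)
      ((tensorDelta.obj X).obj (plus.obj (SSet.boundary.{0} n))) where
  hom e he := plusι X (SSet.boundary.{0} n) e.dim ⟨SSet.stdSimplex.objEquiv.symm e.toMor, he⟩
  comm {e _} f _ _ := (plusι_face _ _ _ _).trans (congrArg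
    (plusι X (SSet.boundary.{0} n) e.dim) (Subtype.ext
      (congrArg SSet.stdSimplex.objEquiv.symm (Chain.mor_toMor f))))

lemma boundaryFamily_latchingMap (X : SimplexCategory ⥤ C) {n : ℕ} (e : Chain (Fin (n + 1)))
    (he : Chain.boundary n e) : (boundaryFamily X n).hom e he ≫ latchingMap X n = stdι X e :=
  plusι_map _ _ _ _

lemma std_hom_ext {X : SimplexCategory ⥤ C} {n : ℕ} {T : C}
    {f g : (tensorDelta.obj X).obj (plus.obj Δ[n]) ⟶ T}
    (h : stdι X (Chain.top n) ≫ f = stdι X (Chain.top n) ≫ g) : f = g := by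
  refine plus_hom_ext fun m x ↦ ?_
  change stdι X (Chain.ofMor (SSet.stdSimplex.objEquiv x)) ≫ f =
    stdι X (Chain.ofMor (SSet.stdSimplex.objEquiv x)) ≫ g
  rw [← reassoc_of% stdι_eq, h, reassoc_of% stdι_eq]

lemma boundary_hom_ext {X : SimplexCategory ⥤ C} {n : ℕ} {T : C}
    {f g : (tensorDelta.obj X).obj (plus.obj (SSet.boundary.{0} n)) ⟶ T}
    (h : ∀ e he, (boundaryFamily X n).hom e he ≫ f = (boundaryFamily X n).hom e he ≫ g) :
    f = g :=
  plus_hom_ext fun _ x ↦ h (Chain.ofMor (SSet.stdSimplex.objEquiv x.1)) x.2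

lemma exists_std_desc {X : SimplexCategory ⥤ C} {n : ℕ} {T : C} (h : X.obj ⦋n⦌ ⟶ T) :
    ∃ g : (tensorDelta.obj X).obj (plus.obj Δ[n]) ⟶ T,
      ∀ e : Chain (Fin (n + 1)), stdι X e ≫ g = X.map e.toMor ≫ h := by
  obtain ⟨g, hg⟩ := exists_plus_desc (X := X) (K := Δ[n])
    (fun m x ↦ X.map (SSet.stdSimplex.objEquiv x) ≫ h)
    (fun {m l} f x ↦ by rw [← X.map_comp_assoc]; rfl)
  exact ⟨g, fun e ↦ hg _ _⟩

lemma exists_boundary_desc {X : SimplexCategory ⥤ C} {n : ℕ} {T : C}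
    (k : Family (Chain.functor X (Fin (n + 1))) (Chain.boundary n) T) :
    ∃ g : (tensorDelta.obj X).obj (plus.obj (SSet.boundary.{0} n)) ⟶ T,
      ∀ e he, (boundaryFamily X n).hom e he ≫ g = k.hom e he := by
  obtain ⟨g, hg⟩ := exists_plus_desc (X := X) (K := SSet.boundary.{0} n)
    (fun m x ↦ k.hom (Chain.ofMor (SSet.stdSimplex.objEquiv x.1)) x.2)
    (fun {m l} f x ↦ k.comm
      (show Chain.ofMor (f ≫ SSet.stdSimplex.objEquiv x.1) ⟶
        Chain.ofMor (SSet.stdSimplex.objEquiv x.1) from ⟨f, fun _ ↦ rfl⟩)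
      ((SSet.boundary.{0} n : SSet).map f.op x).2 x.2)
  exact ⟨g, fun e he ↦ hg _ _⟩

lemma hasLiftingProperty_latchingMap_iff (A : SimplexCategory ⥤ C) (n : ℕ) {Z W : C}
    (p : Z ⟶ W) : HasLiftingProperty (latchingMap A n) p ↔ BoundaryLift A n p := by
  constructor
  · intro _ k g hg
    obtain ⟨a, ha⟩ := exists_boundary_desc k
    obtain ⟨b, hb⟩ := exists_std_desc g
    obtain ⟨d, hd₁, hd₂⟩ := exists_lift (latchingMap A n) p (a := a) (b := b) (by
      refine boundary_hom_ext fun e he ↦ ?_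
      rw [reassoc_of% boundaryFamily_latchingMap, hb, reassoc_of% (ha e he),
        ← hg _ ((Chain.isTerminalTop n).from e)]
      rfl)
    refine ⟨stdι A (Chain.top n) ≫ d, fun e u he ↦ ?_, ?_⟩
    · dsimp only
      rw [reassoc_of% stdι_face, ← ha, ← hd₁, reassoc_of% boundaryFamily_latchingMap]
    · rw [Category.assoc, hd₂, hb]
      exact (congrArg (· ≫ _) (A.map_id _)).trans (Category.id_comp _)
  · intro h
    refine hasLiftingProperty_of_exists fun a b hab ↦ ?_
    obtain ⟨d, hd₁, hd₂⟩ := h ((boundaryFamily A n).comp a) (stdι A (Chain.top n) ≫ b) (by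
      intro e u he
      rw [Family.comp_hom, Category.assoc, hab, reassoc_of% boundaryFamily_latchingMap]
      exact (reassoc_of% (stdι_face A u)) b)
    obtain ⟨d', hd'⟩ := exists_std_desc (X := A) d
    have hd'' : stdι A (Chain.top n) ≫ d' = d :=
      (hd' _).trans ((congrArg (· ≫ _) (A.map_id _)).trans (Category.id_comp _))
    refine ⟨d', boundary_hom_ext fun e he ↦ ?_, std_hom_ext ?_⟩
    · rw [reassoc_of% boundaryFamily_latchingMap, ← Family.comp_hom,
        ← hd₁ e ((Chain.isTerminalTop n).from e) he, hd']
      rfl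
    · rw [reassoc_of% hd'', hd₂]

/-- Reedy cofibrancy, in terms of lifting problems for families. -/
lemma isReedyCofibrant_iff [ModelCategory C] (A : SimplexCategory ⥤ C) :
    IsReedyCofibrant A ↔ ∀ (n : ℕ) {Z W : C} (p : Z ⟶ W) [Fibration p] [WeakEquivalence p],
      BoundaryLift A n p := by
  refine forall_congr' fun n ↦ ⟨fun h Z W p _ _ ↦ ?_, fun h ↦ ?_⟩
  · rw [← hasLiftingProperty_latchingMap_iff]
    infer_instance
  · refine cofibration_of_hasLiftingProperty fun p _ _ ↦ ?_
    rw [hasLiftingProperty_latchingMap_iff]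
    exact h p

variable [ModelCategory C]

/-- For a Reedy cofibrant `A` and a trivial fibration `p`, families extend from every subcomplex
of the nerve of a finite partially ordered set. -/
lemma IsReedyCofibrant.hasExtension {A : SimplexCategory ⥤ C} (hA : IsReedyCofibrant A)
    {Q : Type} [PartialOrder Q] [Finite Q] {F : ObjectProperty (Chain Q)} (hF : IsLower F)
    {Z W : C} (p : Z ⟶ W) [Fibration p] [WeakEquivalence p] :
    HasExtension (Chain.functor A Q) F ⊤ p := by
  refine hasExtension_top Chain.range hF fun F' hF' _ hex ↦ ?_
  obtain ⟨e, he, hnd, hmin⟩ := Chain.exists_minimal hF' hex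
  exact ⟨e, he, hnd.subsingleton, fun e' h ↦ hnd.nonempty_hom h.subset,
    ((isReedyCofibrant_iff A).1 hA _ p).cellLift hmin⟩

/-- Structure maps along monomorphisms are cofibrations: a family on the simplices of a face
extends to the standard simplex. -/
lemma IsReedyCofibrant.cofibration_map {A : SimplexCategory ⥤ C} (hA : IsReedyCofibrant A)
    {m : SimplexCategory} {n : ℕ} (f : m ⟶ ⦋n⦌) [Mono f] : Cofibration (A.map f) := by
  refine cofibration_of_hasLiftingProperty fun {Z W} p _ _ ↦
    hasLiftingProperty_of_exists fun a b hab ↦ ?_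
  let F : ObjectProperty (Chain (Fin (n + 1))) := fun e ↦ ∃ g : e.dim ⟶ m, g ≫ f = e.toMor
  have hF : IsLower F := by
    rintro e e' u ⟨g, hg⟩
    exact ⟨u.mor ≫ g, by rw [Category.assoc, hg, Chain.mor_toMor]⟩
  let k : Family (Chain.functor A _) F Z :=
    { hom := fun e he ↦ A.map he.choose ≫ a
      comm := fun {e e'} u he he' ↦ by
        change A.map u.mor ≫ _ = _
        rw [← A.map_comp_assoc]
        congr 2
        rw [← cancel_mono f, Category.assoc, he'.choose_spec, he.choose_spec, Chain.mor_toMor] }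
  let l : Family (Chain.functor A _) ⊤ W := Family.ofTerminal (Chain.isTerminalTop n) ⊤ b
  obtain ⟨k', h₁, h₂⟩ := hA.hasExtension hF p k l (fun e he he' ↦ by
    change (A.map he.choose ≫ a) ≫ p = A.map e.toMor ≫ b
    rw [Category.assoc, hab, ← A.map_comp_assoc, he.choose_spec])
  refine ⟨k'.hom (Chain.top n) trivial, ?_, ?_⟩
  · have he : F (Chain.ofMor f) := ⟨𝟙 m, Category.id_comp _⟩
    have h₃ : he.choose = 𝟙 m := by
      rw [← cancel_mono f, he.choose_spec, Category.id_comp]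
      rfl
    have h₄ : A.map he.choose ≫ a = a := by rw [h₃, A.map_id, Category.id_comp]
    exact (k'.comm ((Chain.isTerminalTop n).from (Chain.ofMor f)) trivial trivial).trans
      ((h₁ _ he trivial).trans h₄)
  · rw [h₂]
    change A.map ((Chain.isTerminalTop n).from (Chain.top n)).mor ≫ b = b
    rw [(Chain.isTerminalTop n).hom_ext ((Chain.isTerminalTop n).from (Chain.top n)) (𝟙 _)]
    exact (congrArg (· ≫ _) (A.map_id _)).trans (Category.id_comp _)

lemma IsReedyCofibrant.isCofibrant {A : SimplexCategory ⥤ C} (hA : IsReedyCofibrant A) (n : ℕ) :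
    IsCofibrant (A.obj ⦋n⦌) := by
  refine cofibration_of_hasLiftingProperty fun {Z W} p _ _ ↦
    hasLiftingProperty_of_exists fun a b hab ↦ ?_
  obtain ⟨k', h₁, h₂⟩ := hA.hasExtension (Q := Fin (n + 1)) (F := ⊥) (fun _ _ _ h ↦ h) p
    ⟨fun _ h ↦ h.elim, fun _ h ↦ h.elim⟩ (Family.ofTerminal (Chain.isTerminalTop n) ⊤ b)
    (fun _ h ↦ h.elim)
  refine ⟨k'.hom (Chain.top n) trivial, Subsingleton.elim _ _, ?_⟩
  rw [h₂]
  change A.map ((Chain.isTerminalTop n).from (Chain.top n)).mor ≫ b = b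
  rw [(Chain.isTerminalTop n).hom_ext ((Chain.isTerminalTop n).from (Chain.top n)) (𝟙 _)]
  exact (congrArg (· ≫ _) (A.map_id _)).trans (Category.id_comp _)

lemma IsCosimplicialResolution.cofibration_coface {A : SimplexCategory ⥤ C}
    (hA : IsCosimplicialResolution A) {n : ℕ} (i : Fin (n + 2)) :
    Cofibration (A.map (SimplexCategory.δ i)) :=
  hA.reedyCofibrant.cofibration_map (SimplexCategory.δ i)

end Tensor

section BoundaryColimit

variable {C : Type u} [Category.{v} C] [HasColimitsOfSize.{0, 0} C]

/-- The latching map of `A` in degree `n`, with the latching object written as a colimit over the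
simplices of the boundary. -/
def boundaryColimitMap (A : SimplexCategory ⥤ C) (n : ℕ) :
    familyColimit (Chain.functor A (Fin (n + 1))) (Chain.boundary n) ⟶ A.obj ⦋n⦌ :=
  Family.desc
    { hom := fun e _ ↦ A.map e.toMor
      comm := fun f _ _ ↦ by rw [← A.map_comp, Chain.mor_toMor] }

lemma ι_boundaryColimitMap (A : SimplexCategory ⥤ C) {n : ℕ} (e : Chain (Fin (n + 1)))
    (he : Chain.boundary n e) :
    (familyColimit.ι _ _).hom e he ≫ boundaryColimitMap A n = A.map e.toMor :=
  Family.ι_desc _ e he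

lemma IsReedyCofibrant.cofibration_boundaryColimitMap [HasZeroMorphisms C] [ModelCategory C]
    {A : SimplexCategory ⥤ C} (hA : IsReedyCofibrant A) (n : ℕ) :
    Cofibration (boundaryColimitMap A n) := by
  refine cofibration_of_hasLiftingProperty fun p _ _ ↦
    hasLiftingProperty_of_exists fun a b hab ↦ ?_
  obtain ⟨d, h₁, h₂⟩ := (isReedyCofibrant_iff A).1 hA n p ((familyColimit.ι _ _).comp a) b
    (fun e u he ↦ by
      rw [Family.comp_hom, Category.assoc, hab, reassoc_of% ι_boundaryColimitMap,
        ← Chain.mor_eq_toMor u])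
  refine ⟨d, familyColimit.hom_ext fun e he ↦ ?_, h₂⟩
  rw [reassoc_of% ι_boundaryColimitMap]
  exact h₁ e ((Chain.isTerminalTop n).from e) he

end BoundaryColimit

/-! ### Pushout products -/

section PushoutProduct

variable {C : Type u} [Category.{v} C] [ModelCategory C] [MonoidalCategory C]

/-- Lifting against a pushout product, with the maps out of the pushout given by their
components. -/
lemma exists_lift_pushoutProduct {A B X Y Z W : C} (i : A ⟶ B) (j : X ⟶ Y) (p : Z ⟶ W)
    [HasLiftingProperty ((Arrow.pushoutProduct.obj (Arrow.mk i)).obj (Arrow.mk j)).hom p]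
    {a : A ⊗ Y ⟶ Z} {b : B ⊗ X ⟶ Z} (hab : A ◁ j ≫ a = i ▷ X ≫ b) {g : B ⊗ Y ⟶ W}
    (ha : i ▷ Y ≫ g = a ≫ p) (hb : B ◁ j ≫ g = b ≫ p) :
    ∃ d : B ⊗ Y ⟶ Z, i ▷ Y ≫ d = a ∧ B ◁ j ≫ d = b ∧ d ≫ p = g := by
  let sq := Functor.PushoutObjObj.ofHasPushout (curriedTensor C) i j
  have : HasLiftingProperty sq.ι p := ‹_›
  have hinl : sq.inl ≫ sq.ι = B ◁ j := sq.inl_ι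
  have hinr : sq.inr ≫ sq.ι = i ▷ Y := sq.inr_ι
  obtain ⟨d, hd₁, hd₂⟩ := exists_lift sq.ι p (a := sq.isPushout.desc b a hab.symm) (b := g) (by
    refine sq.isPushout.hom_ext ?_ ?_
    · rw [sq.isPushout.inl_desc_assoc, reassoc_of% hinl, hb]
    · rw [sq.isPushout.inr_desc_assoc, reassoc_of% hinr, ha])
  refine ⟨d, ?_, ?_, hd₂⟩
  · rw [← hinr, Category.assoc, hd₁, sq.isPushout.inr_desc]
  · rw [← hinl, Category.assoc, hd₁, sq.isPushout.inl_desc]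

variable [SymmetricCategory C] [IsMonoidalModelCategory C]

instance (X : C) : PreservesColimitsOfSize.{0, 0} (tensorLeft X) :=
  IsMonoidalModelCategory.preservesColimits X

instance (X : C) : PreservesColimitsOfSize.{0, 0} (tensorRight X) :=
  preservesColimits_of_natIso (BraidedCategory.tensorLeftIsoTensorRight X)

instance {A B X Y : C} (i : A ⟶ B) (j : X ⟶ Y) [Cofibration i] [Cofibration j] :
    Cofibration ((Arrow.pushoutProduct.obj (Arrow.mk i)).obj (Arrow.mk j)).hom :=
  IsMonoidalModelCategory.cofibration_pushoutProduct i j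

/-- The product of an initial object with any object is initial. -/
def isInitialTensor (X : C) : IsInitial (X ⊗ (⊥_ C)) :=
  IsInitial.isInitialObj (tensorLeft X) _ initialIsInitial

/-- The product of any object with an initial object is initial. -/
def isInitialTensor' (X : C) : IsInitial ((⊥_ C) ⊗ X) :=
  IsInitial.isInitialObj (tensorRight X) _ initialIsInitial

lemma hasLiftingProperty_whiskerRight {A B Y Z W : C} (i : A ⟶ B) (p : Z ⟶ W)
    [HasLiftingProperty
      ((Arrow.pushoutProduct.obj (Arrow.mk i)).obj (Arrow.mk (initial.to Y))).hom p] :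
    HasLiftingProperty (i ▷ Y) p := by
  refine hasLiftingProperty_of_exists fun a b hab ↦ ?_
  obtain ⟨d, h₁, -, h₂⟩ := exists_lift_pushoutProduct i (initial.to Y) p (a := a)
    (b := (isInitialTensor B).to Z) ((isInitialTensor A).hom_ext _ _) (g := b) hab.symm
    ((isInitialTensor B).hom_ext _ _)
  exact ⟨d, h₁, h₂⟩

lemma hasLiftingProperty_whiskerLeft {B X Y Z W : C} (j : X ⟶ Y) (p : Z ⟶ W)
    [HasLiftingProperty
      ((Arrow.pushoutProduct.obj (Arrow.mk (initial.to B))).obj (Arrow.mk j)).hom p] :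
    HasLiftingProperty (B ◁ j) p := by
  refine hasLiftingProperty_of_exists fun a b hab ↦ ?_
  obtain ⟨d, -, h₁, h₂⟩ := exists_lift_pushoutProduct (initial.to B) j p (b := a)
    (a := (isInitialTensor' Y).to Z) ((isInitialTensor' X).hom_ext _ _) (g := b)
    ((isInitialTensor' Y).hom_ext _ _) hab.symm
  exact ⟨d, h₁, h₂⟩

lemma cofibration_whiskerRight {A B : C} (i : A ⟶ B) [Cofibration i] (Y : C) [IsCofibrant Y] :
    Cofibration (i ▷ Y) :=
  cofibration_of_hasLiftingProperty fun p _ _ ↦ hasLiftingProperty_whiskerRight i p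

lemma weakEquivalence_whiskerRight {A B : C} (i : A ⟶ B) [Cofibration i] [WeakEquivalence i]
    (Y : C) [IsCofibrant Y] : WeakEquivalence (i ▷ Y) :=
  have := IsMonoidalModelCategory.weakEquivalence_pushoutProduct i (initial.to Y) (.inl ‹_›)
  (trivialCofibration_of_hasLiftingProperty fun p _ ↦ hasLiftingProperty_whiskerRight i p).2

lemma weakEquivalence_whiskerLeft (B : C) [IsCofibrant B] {X Y : C} (j : X ⟶ Y) [Cofibration j]
    [WeakEquivalence j] : WeakEquivalence (B ◁ j) :=
  have := IsMonoidalModelCategory.weakEquivalence_pushoutProduct (initial.to B) j (.inr ‹_›)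
  (trivialCofibration_of_hasLiftingProperty fun p _ ↦ hasLiftingProperty_whiskerLeft j p).2

end PushoutProduct

/-! ### The levelwise product of cosimplicial resolutions -/

section ExternalProduct

variable {C : Type u} [Category.{v} C] [MonoidalCategory C]

/-- The external product of two cosimplicial objects, as a functor
`(e, e') ↦ A^(dim e) ⊗ B^(dim e')` on pairs of simplices of nerves. -/
abbrev externalProduct (A B : SimplexCategory ⥤ C) (Q Q' : Type) [PartialOrder Q]
    [PartialOrder Q'] : Chain Q × Chain Q' ⥤ C where
  obj e := A.obj e.1.dim ⊗ B.obj e.2.dim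
  map f := A.map f.1.mor ⊗ₘ B.map f.2.mor
  map_id e := by
    change A.map (𝟙 _) ⊗ₘ B.map (𝟙 _) = _
    simp
  map_comp f g := by
    change A.map (f.1.mor ≫ g.1.mor) ⊗ₘ B.map (f.2.mor ≫ g.2.mor) = _
    simp

/-- The cells of an external product: families extend over a pair of simplices when the pushout
product of the two latching maps lifts. -/
lemma cellLift_externalProduct [ModelCategory C] [HasColimitsOfSize.{0, 0} C]
    [SymmetricCategory C] [IsMonoidalModelCategory C] {A B : SimplexCategory ⥤ C} {Q Q' : Type}
    [PartialOrder Q] [PartialOrder Q'] {e : Chain Q × Chain Q'} {Z W : C} {p : Z ⟶ W}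
    [HasLiftingProperty ((Arrow.pushoutProduct.obj
      (Arrow.mk (boundaryColimitMap A e.1.dim.len))).obj
      (Arrow.mk (boundaryColimitMap B e.2.dim.len))).hom p]
    {F : ObjectProperty (Chain Q × Chain Q')}
    (hF : ∀ e' (u : e' ⟶ e), F e' ↔ ¬ (Function.Surjective u.1.mor.toOrderHom ∧
      Function.Surjective u.2.mor.toOrderHom)) :
    CellLift (externalProduct A B Q Q') F e p := by
  intro k g hg
  obtain ⟨e₁, e₂⟩ := e
  have hF₁ : ∀ (x : Chain (Fin (e₁.dim.len + 1))) (e' : Chain Q') (u : e' ⟶ e₂),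
      Chain.boundary _ x → F (e₁.overFunctor.obj x, e') := fun x e' u hx ↦
    (hF (e₁.overFunctor.obj x, e') (e₁.overHom x, u)).2 fun h ↦ hx h.1
  have hF₂ : ∀ (e' : Chain Q) (u : e' ⟶ e₁) (y : Chain (Fin (e₂.dim.len + 1))),
      Chain.boundary _ y → F (e', e₂.overFunctor.obj y) := fun e' u y hy ↦
    (hF (e', e₂.overFunctor.obj y) (u, e₂.overHom y)).2 fun h ↦ hy h.2
  -- the two restrictions of the family to the boundary of the product of two simplices
  obtain ⟨a, ha⟩ := Family.exists_desc_map (X := Chain.functor A (Fin (e₁.dim.len + 1)))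
    (F := Chain.boundary _) (tensorRight (B.obj e₂.dim))
    { hom := fun x hx ↦ k.hom (e₁.overFunctor.obj x, e₂) (hF₁ x e₂ (𝟙 _) hx)
      comm := fun {x x'} f hx hx' ↦ by
        have := k.comm (e := (e₁.overFunctor.obj x, e₂)) (e' := (e₁.overFunctor.obj x', e₂))
          (e₁.overFunctor.map f, 𝟙 _) (hF₁ x e₂ (𝟙 _) hx) (hF₁ x' e₂ (𝟙 _) hx')
        rw [← this]
        change (A.map f.mor ▷ _) ≫ _ = (A.map f.mor ⊗ₘ B.map (𝟙 _)) ≫ _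
        rw [B.map_id, tensorHom_id] }
  obtain ⟨b, hb⟩ := Family.exists_desc_map (X := Chain.functor B (Fin (e₂.dim.len + 1)))
    (F := Chain.boundary _) (tensorLeft (A.obj e₁.dim))
    { hom := fun y hy ↦ k.hom (e₁, e₂.overFunctor.obj y) (hF₂ e₁ (𝟙 _) y hy)
      comm := fun {y y'} f hy hy' ↦ by
        have := k.comm (e := (e₁, e₂.overFunctor.obj y)) (e' := (e₁, e₂.overFunctor.obj y'))
          (𝟙 _, e₂.overFunctor.map f) (hF₂ e₁ (𝟙 _) y hy) (hF₂ e₁ (𝟙 _) y' hy')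
        rw [← this]
        change (_ ◁ B.map f.mor) ≫ _ = (A.map (𝟙 _) ⊗ₘ B.map f.mor) ≫ _
        rw [A.map_id, id_tensorHom] }
  have ha' : ∀ x hx, (familyColimit.ι (Chain.functor A _) (Chain.boundary _)).hom x hx ▷
      B.obj e₂.dim ≫ a = k.hom (e₁.overFunctor.obj x, e₂) (hF₁ x e₂ (𝟙 _) hx) := ha
  have hb' : ∀ y hy, A.obj e₁.dim ◁
      (familyColimit.ι (Chain.functor B _) (Chain.boundary _)).hom y hy ≫ b =
      k.hom (e₁, e₂.overFunctor.obj y) (hF₂ e₁ (𝟙 _) y hy) := hb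
  have ka : ∀ x hx (y : Chain (Fin (e₂.dim.len + 1))),
      A.obj x.dim ◁ B.map y.toMor ≫ k.hom (e₁.overFunctor.obj x, e₂) (hF₁ x e₂ (𝟙 _) hx) =
      k.hom (e₁.overFunctor.obj x, e₂.overFunctor.obj y) (hF₁ x _ (e₂.overHom y) hx) := by
    intro x hx y
    have := k.comm (e := (e₁.overFunctor.obj x, e₂.overFunctor.obj y))
      (e' := (e₁.overFunctor.obj x, e₂)) (𝟙 _, e₂.overHom y) (hF₁ x _ (e₂.overHom y) hx)
      (hF₁ x e₂ (𝟙 _) hx)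
    rw [← this]
    change _ = (A.map (𝟙 _) ⊗ₘ B.map y.toMor) ≫ _
    rw [A.map_id, id_tensorHom]
  have kb : ∀ (x : Chain (Fin (e₁.dim.len + 1))) y hy,
      A.map x.toMor ▷ B.obj y.dim ≫ k.hom (e₁, e₂.overFunctor.obj y) (hF₂ e₁ (𝟙 _) y hy) =
      k.hom (e₁.overFunctor.obj x, e₂.overFunctor.obj y) (hF₂ _ (e₁.overHom x) y hy) := by
    intro x y hy
    have := k.comm (e := (e₁.overFunctor.obj x, e₂.overFunctor.obj y))
      (e' := (e₁, e₂.overFunctor.obj y)) (e₁.overHom x, 𝟙 _) (hF₂ _ (e₁.overHom x) y hy)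
      (hF₂ e₁ (𝟙 _) y hy)
    rw [← this]
    change _ = (A.map x.toMor ⊗ₘ B.map (𝟙 _)) ≫ _
    rw [B.map_id, tensorHom_id]
  have hg' : ∀ {e' : Chain Q × Chain Q'} (u : e' ⟶ (e₁, e₂)) (he' : F e'),
      (A.map u.1.mor ⊗ₘ B.map u.2.mor) ≫ g = k.hom e' he' ≫ p := fun u he' ↦ hg _ u he'
  obtain ⟨d, hd₁, hd₂, hd₃⟩ := exists_lift_pushoutProduct
    (boundaryColimitMap A e₁.dim.len) (boundaryColimitMap B e₂.dim.len) p
    (a := a) (b := b) (g := g) (by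
      refine familyColimit.map_hom_ext (tensorRight _) fun x hx ↦
        familyColimit.map_hom_ext (tensorLeft _) fun y hy ↦ ?_
      change _ ◁ _ ≫ _ ▷ _ ≫ _ ◁ _ ≫ _ = _ ◁ _ ≫ _ ▷ _ ≫ _ ▷ _ ≫ _
      rw [← whisker_exchange_assoc, ha', ← whiskerLeft_comp_assoc, ι_boundaryColimitMap,
        ← comp_whiskerRight_assoc, ι_boundaryColimitMap, whisker_exchange_assoc, hb', ka, kb]
      exacts [hy, hx])
    (by
      refine familyColimit.map_hom_ext (tensorRight _) fun x hx ↦ ?_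
      change _ ▷ _ ≫ _ ▷ _ ≫ _ = _ ▷ _ ≫ _ ≫ _
      rw [reassoc_of% (ha' x hx), ← comp_whiskerRight_assoc, ι_boundaryColimitMap,
        ← hg' (e' := (e₁.overFunctor.obj x, e₂)) (e₁.overHom x, 𝟙 _)]
      change _ = (A.map x.toMor ⊗ₘ B.map (𝟙 _)) ≫ _
      rw [B.map_id, tensorHom_id])
    (by
      refine familyColimit.map_hom_ext (tensorLeft _) fun y hy ↦ ?_
      change _ ◁ _ ≫ _ ◁ _ ≫ _ = _ ◁ _ ≫ _ ≫ _
      rw [reassoc_of% (hb' y hy), ← whiskerLeft_comp_assoc, ι_boundaryColimitMap,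
        ← hg' (e' := (e₁, e₂.overFunctor.obj y)) (𝟙 _, e₂.overHom y)]
      change _ = (A.map (𝟙 _) ⊗ₘ B.map y.toMor) ≫ _
      rw [A.map_id, id_tensorHom])
  refine ⟨d, fun ⟨e₁', e₂'⟩ ⟨u₁, u₂⟩ he' ↦ ?_, hd₃⟩
  change (A.map u₁.mor ⊗ₘ B.map u₂.mor) ≫ d = _
  rcases not_and_or.1 ((hF _ (u₁, u₂)).1 he') with h | h
  · let x : Chain (Fin (e₁.dim.len + 1)) := ⟨e₁'.dim, u₁.mor.toOrderHom⟩
    have hxb : Chain.boundary _ x := h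
    have hx : A.map u₁.mor = (familyColimit.ι _ _).hom x hxb ≫ boundaryColimitMap A _ :=
      (ι_boundaryColimitMap A x hxb).symm
    have h₁ := k.comm (e := (e₁', e₂')) (e' := (e₁.overFunctor.obj x, e₂))
      (⟨𝟙 _, fun i ↦ u₁.fac i⟩, u₂) he' (hF₁ x e₂ (𝟙 _) hxb)
    change (A.map (𝟙 _) ⊗ₘ B.map u₂.mor) ≫ _ = _ at h₁
    rw [A.map_id, id_tensorHom] at h₁
    rw [tensorHom_def', hx, comp_whiskerRight, Category.assoc, Category.assoc, hd₁]
    exact (congrArg (_ ≫ ·) (ha' x hxb)).trans h₁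
  · let y : Chain (Fin (e₂.dim.len + 1)) := ⟨e₂'.dim, u₂.mor.toOrderHom⟩
    have hyb : Chain.boundary _ y := h
    have hy : B.map u₂.mor = (familyColimit.ι _ _).hom y hyb ≫ boundaryColimitMap B _ :=
      (ι_boundaryColimitMap B y hyb).symm
    have h₁ := k.comm (e := (e₁', e₂')) (e' := (e₁, e₂.overFunctor.obj y))
      (u₁, ⟨𝟙 _, fun i ↦ u₂.fac i⟩) he' (hF₂ e₁ (𝟙 _) y hyb)
    change (A.map u₁.mor ⊗ₘ B.map (𝟙 _)) ≫ _ = _ at h₁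
    rw [B.map_id, tensorHom_id] at h₁
    rw [MonoidalCategory.tensorHom_def, hy, whiskerLeft_comp, Category.assoc, Category.assoc, hd₂]
    exact (congrArg (_ ≫ ·) (hb' y hyb)).trans h₁

end ExternalProduct

section Product

variable {C : Type u} [Category.{v} C]

/-- Every nonempty set of vertices spans a nondegenerate simplex of `[n]`. -/
lemma Chain.exists_range_eq {n : ℕ} {S : Set (Fin (n + 1))} (hS : S.Nonempty) :
    ∃ w : Chain (Fin (n + 1)), w.Nondegenerate ∧ w.range = S := by
  classical
  have hT : S.toFinset.Nonempty := by simpa using hS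
  refine ⟨(Chain.top n).pull (Chain.faceHom (m := ⦋n⦌) S.toFinset hT),
    Chain.faceHom_injective (m := ⦋n⦌) S.toFinset hT, ?_⟩
  exact (Chain.range_faceHom (m := ⦋n⦌) S.toFinset hT).trans (by simp)

/-- Pairs of simplices of `[n]` that lie in a common proper face. -/
def commonFace (n : ℕ) : ObjectProperty (Chain (Fin (n + 1)) × Chain (Fin (n + 1))) :=
  fun e ↦ e.1.range ∪ e.2.range ≠ Set.univ

lemma isLower_commonFace (n : ℕ) : IsLower (commonFace n) := by
  intro e e' f h h'
  refine h (Set.univ_subset_iff.1 (h'.symm.subset.trans ?_))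
  exact Set.union_subset_union (Chain.range_subset f.1) (Chain.range_subset f.2)

/-- The smallest face containing both simplices of a pair. -/
lemma commonFace.exists_face {n : ℕ} {e : Chain (Fin (n + 1)) × Chain (Fin (n + 1))}
    (he : commonFace n e) :
    ∃ w : Chain (Fin (n + 1)), w.Nondegenerate ∧ Chain.boundary n w ∧
      w.range = e.1.range ∪ e.2.range ∧ Nonempty (e.1 ⟶ w) ∧ Nonempty (e.2 ⟶ w) := by
  obtain ⟨w, hw, hw'⟩ := Chain.exists_range_eq (S := e.1.range ∪ e.2.range)
    ⟨e.1.vert 0, Or.inl ⟨0, rfl⟩⟩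
  refine ⟨w, hw, fun h ↦ he ?_, hw', hw.nonempty_hom ?_, hw.nonempty_hom ?_⟩
  · rw [← hw']
    exact h.range_eq
  · rw [hw']
    exact Set.subset_union_left
  · rw [hw']
    exact Set.subset_union_right

variable [MonoidalCategory C]

/-- The levelwise product `A ⊗ B`, in a form that unfolds reducibly. -/
abbrev levelTensor (A B : SimplexCategory ⥤ C) : SimplexCategory ⥤ C where
  obj m := A.obj m ⊗ B.obj m
  map f := A.map f ⊗ₘ B.map f

lemma levelTensor_eq (A B : SimplexCategory ⥤ C) : levelTensor A B = A ⊗ B := rfl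

/-- A family on the boundary of the diagonal of `A ⊗ B` extends to the pairs of simplices that lie
in a common proper face: the smallest such face is functorial in the pair. -/
lemma exists_family_commonFace {A B : SimplexCategory ⥤ C} {n : ℕ} {Z : C}
    (h : Family (Chain.functor (levelTensor A B) (Fin (n + 1))) (Chain.boundary n) Z) :
    ∃ k : Family (externalProduct A B (Fin (n + 1)) (Fin (n + 1))) (commonFace n) Z,
      ∀ e he (w : Chain (Fin (n + 1))) (hw : Chain.boundary n w) (f₁ : e.1 ⟶ w) (f₂ : e.2 ⟶ w),
        k.hom e he = (A.map f₁.mor ⊗ₘ B.map f₂.mor) ≫ h.hom w hw := by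
  choose w hnd hbd hrange f₁ f₂ using
    fun (e : _ × _) (he : commonFace n e) ↦ commonFace.exists_face he
  have hcomm : ∀ {w w' : Chain (Fin (n + 1))} (f : w ⟶ w') hw hw',
      (A.map f.mor ⊗ₘ B.map f.mor) ≫ h.hom w' hw' = h.hom w hw := h.comm
  have key : ∀ e he (w' : Chain (Fin (n + 1))) (hw : Chain.boundary n w') (g₁ : e.1 ⟶ w')
      (g₂ : e.2 ⟶ w'), (A.map (f₁ e he).some.mor ⊗ₘ B.map (f₂ e he).some.mor) ≫
        h.hom (w e he) (hbd e he) = (A.map g₁.mor ⊗ₘ B.map g₂.mor) ≫ h.hom w' hw := by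
    intro e he w' hw g₁ g₂
    -- both faces are compared with the nondegenerate simplex spanned by the vertices of `w'`
    obtain ⟨w'', hnd'', hrange''⟩ := Chain.exists_range_eq (S := w'.range) ⟨w'.vert 0, 0, rfl⟩
    have hbd'' : Chain.boundary n w'' := fun h'' ↦ hw (by
      rw [← Set.range_eq_univ]
      change w'.range = _
      rw [← hrange'']
      exact h''.range_eq)
    obtain ⟨a⟩ := hnd''.nonempty_hom hrange''.symm.subset
    obtain ⟨b⟩ := hnd''.nonempty_hom (e' := w e he) (by
      rw [hrange, hrange'']
      exact Set.union_subset (Chain.range_subset g₁) (Chain.range_subset g₂))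
    rw [← hcomm a hw hbd'', ← hcomm b (hbd e he) hbd'', tensorHom_comp_tensorHom_assoc,
      tensorHom_comp_tensorHom_assoc]
    simp only [← Functor.map_comp]
    have h₁ := congrArg Chain.Hom.mor
      ((hnd''.subsingleton e.1).elim ((f₁ e he).some ≫ b) (g₁ ≫ a))
    have h₂ := congrArg Chain.Hom.mor
      ((hnd''.subsingleton e.2).elim ((f₂ e he).some ≫ b) (g₂ ≫ a))
    change (f₁ e he).some.mor ≫ b.mor = g₁.mor ≫ a.mor at h₁
    change (f₂ e he).some.mor ≫ b.mor = g₂.mor ≫ a.mor at h₂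
    rw [h₁, h₂]
  refine ⟨{ hom := fun e he ↦ (A.map (f₁ e he).some.mor ⊗ₘ B.map (f₂ e he).some.mor) ≫
              h.hom (w e he) (hbd e he)
            comm := fun {e e'} f he he' ↦ ?_ }, key⟩
  rw [key e he (w e' he') (hbd e' he') (f.1 ≫ (f₁ e' he').some) (f.2 ≫ (f₂ e' he').some)]
  dsimp only
  rw [tensorHom_comp_tensorHom_assoc, ← A.map_comp, ← B.map_comp]
  rfl

variable [HasZeroMorphisms C] [HasColimitsOfSize.{0, 0} C] [ModelCategory C]
  [SymmetricCategory C] [IsMonoidalModelCategory C]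

/-- For Reedy cofibrant `A` and `B` and a trivial fibration `p`, families on pairs of simplices
extend from every lower class of pairs. -/
lemma IsReedyCofibrant.hasExtension_externalProduct {A B : SimplexCategory ⥤ C}
    (hA : IsReedyCofibrant A) (hB : IsReedyCofibrant B) {Q Q' : Type} [PartialOrder Q] [Finite Q]
    [PartialOrder Q'] [Finite Q'] {F : ObjectProperty (Chain Q × Chain Q')} (hF : IsLower F)
    {Z W : C} (p : Z ⟶ W) [Fibration p] [WeakEquivalence p] :
    HasExtension (externalProduct A B Q Q') F ⊤ p := by
  refine hasExtension_top (fun e ↦ (e.1.range, e.2.range)) hF fun F' hF' _ hex ↦ ?_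
  obtain ⟨e, he, hnd₁, hnd₂, hmin⟩ := Chain.exists_minimal_prod hF' hex
  have := hA.cofibration_boundaryColimitMap e.1.dim.len
  have := hB.cofibration_boundaryColimitMap e.2.dim.len
  refine ⟨e, he, fun e' ↦ ?_, fun e' h ↦ ?_, cellLift_externalProduct hmin⟩
  · have := hnd₁.subsingleton e'.1
    have := hnd₂.subsingleton e'.2
    exact inferInstanceAs (Subsingleton ((e'.1 ⟶ e.1) × (e'.2 ⟶ e.2)))
  · obtain ⟨h₁, h₂⟩ := Prod.mk.inj h
    obtain ⟨f₁⟩ := hnd₁.nonempty_hom h₁.subset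
    obtain ⟨f₂⟩ := hnd₂.nonempty_hom h₂.subset
    exact ⟨(f₁, f₂)⟩

/-- The levelwise product of Reedy cofibrant objects is Reedy cofibrant. The values of the
prescribed family on the boundary determine those on all pairs of simplices in a common proper face. -/
lemma IsReedyCofibrant.tensor {A B : SimplexCategory ⥤ C}
    (hA : IsReedyCofibrant A) (hB : IsReedyCofibrant B) : IsReedyCofibrant (A ⊗ B) := by
  rw [← levelTensor_eq, isReedyCofibrant_iff]
  intro n Z W p _ _ h g hg
  obtain ⟨k, hk⟩ := exists_family_commonFace h
  obtain ⟨k', h₁, h₂⟩ := hA.hasExtension_externalProduct hB (isLower_commonFace n) p k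
    { hom := fun e _ ↦ (A.map e.1.toMor ⊗ₘ B.map e.2.toMor) ≫ g
      comm := fun f _ _ ↦ by
        rw [tensorHom_comp_tensorHom_assoc, ← A.map_comp, ← B.map_comp, Chain.mor_toMor,
          Chain.mor_toMor] }
    (fun e he he' ↦ by
      obtain ⟨w, -, hw, -, ⟨f₁⟩, ⟨f₂⟩⟩ := he.exists_face
      have : (A.map w.toMor ⊗ₘ B.map w.toMor) ≫ g = h.hom w hw ≫ p :=
        hg w ((Chain.isTerminalTop n).from w) hw
      rw [hk e he w hw f₁ f₂, Category.assoc, ← this, tensorHom_comp_tensorHom_assoc,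
        ← A.map_comp, ← B.map_comp, Chain.mor_toMor, Chain.mor_toMor])
  refine ⟨k'.hom (Chain.top n, Chain.top n) trivial, fun e u he ↦ ?_, ?_⟩
  · have he' : commonFace n (e, e) := by
      intro h'
      rw [Set.union_self] at h'
      exact he (Set.range_eq_univ.1 h')
    refine (k'.comm (e := (e, e)) (e' := (Chain.top n, Chain.top n)) (u, u)
      trivial trivial).trans ?_
    rw [h₁ _ he', hk _ he' e he (𝟙 _) (𝟙 _)]
    change (A.map (𝟙 _) ⊗ₘ B.map (𝟙 _)) ≫ _ = _
    rw [A.map_id, B.map_id, id_tensorHom_id]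
    exact Category.id_comp _
  · refine (h₂ _ _).trans ?_
    change (A.map (𝟙 _) ⊗ₘ B.map (𝟙 _)) ≫ _ = _
    rw [A.map_id, B.map_id, id_tensorHom_id]
    exact Category.id_comp _

/-- The levelwise product of two cosimplicial resolutions is a cosimplicial resolution. -/
theorem IsCosimplicialResolution.tensor {A B : SimplexCategory ⥤ C}
    (hA : IsCosimplicialResolution A) (hB : IsCosimplicialResolution B) :
    IsCosimplicialResolution (A ⊗ B) := by
  rw [← levelTensor_eq]
  have hδ : ∀ (n : ℕ) (i : Fin (n + 2)),
      WeakEquivalence ((levelTensor A B).map (SimplexCategory.δ i)) := by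
    intro n i
    have := hA.reedyCofibrant.isCofibrant (n + 1)
    have := hB.reedyCofibrant.isCofibrant n
    have := hA.cofibration_coface i
    have := hB.cofibration_coface i
    have := hA.weakEquivalence_coface n i
    have := hB.weakEquivalence_coface n i
    have := weakEquivalence_whiskerRight (A.map (SimplexCategory.δ i)) (B.obj ⦋n⦌)
    have := weakEquivalence_whiskerLeft (A.obj ⦋n + 1⦌) (B.map (SimplexCategory.δ i))
    dsimp only
    rw [MonoidalCategory.tensorHom_def]
    infer_instance
  refine ⟨hA.reedyCofibrant.tensor hB.reedyCofibrant, hδ, fun n i ↦ ?_⟩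
  have := hδ n i.castSucc
  have h : (levelTensor A B).map (SimplexCategory.δ i.castSucc) ≫
      (levelTensor A B).map (SimplexCategory.σ i) = 𝟙 _ := by
    rw [← (levelTensor A B).map_comp, SimplexCategory.δ_comp_σ_self]
    exact (levelTensor A B).map_id _
  exact weakEquivalence_of_precomp_of_fac h

end Product

/-! ### Maps out of a suspension -/

section Elements

open Classical in
/-- The class of an element in the pointed set `T / S`. -/
def collapseMk {T : Type} (S : Set T) (t : T) : (collapse S).X :=
  dite (t ∈ S) (fun _ ↦ none) (fun h ↦ (some ⟨t, h⟩ : Option {t : T // t ∉ S}))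

lemma collapseMk_of_mem {T : Type} {S : Set T} {t : T} (h : t ∈ S) :
    collapseMk S t = (collapse S).point := dif_pos h

lemma collapseMk_of_notMem {T : Type} {S : Set T} {t : T} (h : t ∉ S) :
    collapseMk S t = (some ⟨t, h⟩ : Option {t : T // t ∉ S}) := dif_neg h

lemma collapseMap_mk {T T' : Type} {S : Set T} {S' : Set T'} (f : T → T')
    (hf : ∀ t ∈ S, f t ∈ S') (t : T) :
    (collapseMap f hf).toFun (collapseMk S t) = collapseMk S' (f t) := by
  by_cases h : t ∈ S
  · rw [collapseMk_of_mem h, collapseMk_of_mem (hf t h)]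
    rfl
  · rw [collapseMk_of_notMem h]
    rfl

/-- The class of a pair in the smash product of pointed sets. -/
def smashMk {P Q : Pointed.{0}} (p : P.X) (q : Q.X) : (smash P Q).X :=
  collapseMk ({p | p.1 = P.point ∨ p.2 = Q.point} : Set (P.X × Q.X)) (p, q)

lemma smashMap_mk {P P' Q Q' : Pointed.{0}} (f : P ⟶ P') (g : Q ⟶ Q') (p : P.X) (q : Q.X) :
    (smashMap f g).toFun (smashMk p q) = smashMk (f.toFun p) (g.toFun q) :=
  collapseMap_mk (fun p : P.X × Q.X ↦ (f.toFun p.1, g.toFun p.2)) _ _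

/-- The class in `S¹` of a simplex of `Δ[1]`. -/
def circleMk {m : SimplexCategory} (s : m ⟶ ⦋1⦌) : (circle.obj (op m)).X :=
  collapseMk ((SSet.boundary.{0} 1).obj (op m)) (SSet.stdSimplex.objEquiv.symm s)

/-- The class in `S¹ ∧ Δ[n]₊` of a simplex of `Δ[1] × Δ[n]`. -/
def suspensionMk {m n : SimplexCategory} (s : m ⟶ ⦋1⦌) (y : m ⟶ n) :
    (((smashLeft circle).obj (plus.obj (SSet.stdSimplex.{0}.obj n))).obj (op m)).X :=
  smashMk (P := circle.obj (op m)) (Q := (plus.obj (SSet.stdSimplex.{0}.obj n)).obj (op m))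
    (circleMk s) (some (SSet.stdSimplex.objEquiv.symm y))

lemma circleMk_of_not_surjective {m : SimplexCategory} {s : m ⟶ ⦋1⦌}
    (hs : ¬ Function.Surjective s.toOrderHom) : circleMk s = (circle.obj (op m)).point :=
  collapseMk_of_mem hs

lemma suspensionMk_of_not_surjective {m n : SimplexCategory} {s : m ⟶ ⦋1⦌}
    (hs : ¬ Function.Surjective s.toOrderHom) (y : m ⟶ n) :
    suspensionMk s y = (((smashLeft circle).obj
      (plus.obj (SSet.stdSimplex.{0}.obj n))).obj (op m)).point :=
  collapseMk_of_mem (Or.inl (circleMk_of_not_surjective hs))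

lemma circle_map_mk {l m : SimplexCategory} (f : l ⟶ m) (s : m ⟶ ⦋1⦌) :
    (circle.map f.op).toFun (circleMk s) = circleMk (f ≫ s) :=
  collapseMap_mk (S := (SSet.boundary.{0} 1).obj (op m)) (S' := (SSet.boundary.{0} 1).obj (op l))
    (fun t ↦ (Δ[1] : SSet.{0}).map f.op t) (fun _ ht ↦ (SSet.boundary.{0} 1).map f.op ht) _

lemma map_suspensionMk {l m n : SimplexCategory} (f : l ⟶ m) (s : m ⟶ ⦋1⦌) (y : m ⟶ n) :
    (((smashLeft circle).obj (plus.obj (SSet.stdSimplex.{0}.obj n))).map f.op).toFun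
      (suspensionMk s y) = suspensionMk (f ≫ s) (f ≫ y) := by
  refine (smashMap_mk (circle.map f.op) ((plus.obj (SSet.stdSimplex.{0}.obj n)).map f.op)
    (circleMk s) (some (SSet.stdSimplex.objEquiv.symm y))).trans ?_
  exact congrArg (fun t ↦ smashMk (P := circle.obj (op l))
    (Q := (plus.obj (SSet.stdSimplex.{0}.obj n)).obj (op l)) t
    (some (SSet.stdSimplex.objEquiv.symm (f ≫ y)))) (circle_map_mk f s)

lemma suspensionMk_map {m n n' : SimplexCategory} (s : m ⟶ ⦋1⦌) (y : m ⟶ n) (g : n ⟶ n') :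
    (((smashLeft circle).map (plus.map (SSet.stdSimplex.{0}.map g))).app (op m)).toFun
      (suspensionMk s y) = suspensionMk s (y ≫ g) :=
  smashMap_mk (𝟙 (circle.obj (op m))) ((plus.map (SSet.stdSimplex.{0}.map g)).app (op m))
    (circleMk s) (some (SSet.stdSimplex.objEquiv.symm y))

/-- Every simplex of `S¹ ∧ Δ[n]₊` is the base point or comes from a simplex of `Δ[1] × Δ[n]` that
is surjective on the first factor. -/
lemma eq_point_or_eq_suspensionMk {m n : SimplexCategory}
    (x : (((smashLeft circle).obj (plus.obj (SSet.stdSimplex.{0}.obj n))).obj (op m)).X) :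
    x = (((smashLeft circle).obj (plus.obj (SSet.stdSimplex.{0}.obj n))).obj (op m)).point ∨
      ∃ (s : m ⟶ ⦋1⦌) (y : m ⟶ n), x = suspensionMk s y := by
  rcases x with _ | ⟨⟨_ | ⟨s, hs⟩, _ | y⟩, h⟩
  · exact Or.inl rfl
  · exact (h (Or.inl rfl)).elim
  · exact (h (Or.inl rfl)).elim
  · exact (h (Or.inr rfl)).elim
  · refine Or.inr ⟨SSet.stdSimplex.objEquiv s, SSet.stdSimplex.objEquiv y, ?_⟩
    have h₁ : circleMk (SSet.stdSimplex.objEquiv s) = some ⟨s, hs⟩ := collapseMk_of_notMem hs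
    rw [suspensionMk, h₁]
    exact (collapseMk_of_notMem h).symm

lemma suspensionMk_eq_some {m n : SimplexCategory} {s : m ⟶ ⦋1⦌}
    (hs : Function.Surjective s.toOrderHom) (y : m ⟶ n) :
    ∃ h, suspensionMk s y = some ⟨(some ⟨SSet.stdSimplex.objEquiv.symm s, not_not.2 hs⟩,
      some (SSet.stdSimplex.objEquiv.symm y)), h⟩ := by
  have h₁ : circleMk s = some ⟨SSet.stdSimplex.objEquiv.symm s, not_not.2 hs⟩ :=
    collapseMk_of_notMem (not_not.2 hs)
  rw [suspensionMk, h₁]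
  refine ⟨?_, collapseMk_of_notMem ?_⟩ <;>
  · rintro (h | h) <;> cases h

end Elements

section Suspension

variable {C : Type u} [Category.{v} C] [HasZeroMorphisms C] [HasColimitsOfSize.{0, 0} C]

/-- The map `A^m ⟶ (ΣA)^n` belonging to an `m`-simplex of `Δ[1] × Δ[n]`. -/
def suspensionι (A : SimplexCategory ⥤ C) {m n : SimplexCategory} (s : m ⟶ ⦋1⦌) (y : m ⟶ n) :
    A.obj m ⟶ (suspension.obj A).obj n :=
  tensorι A ((smashLeft circle).obj (plus.obj (SSet.stdSimplex.{0}.obj n))) m (suspensionMk s y)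

lemma suspensionι_of_not_surjective (A : SimplexCategory ⥤ C) {m n : SimplexCategory}
    {s : m ⟶ ⦋1⦌} (hs : ¬ Function.Surjective s.toOrderHom) (y : m ⟶ n) :
    suspensionι A s y = 0 := by
  rw [suspensionι, suspensionMk_of_not_surjective hs]
  exact tensorι_point _ _ _

lemma suspensionι_face (A : SimplexCategory ⥤ C) {l m n : SimplexCategory} (f : l ⟶ m)
    (s : m ⟶ ⦋1⦌) (y : m ⟶ n) :
    A.map f ≫ suspensionι A s y = suspensionι A (f ≫ s) (f ≫ y) :=
  (tensorι_face _ _ _ _).trans (congrArg _ (map_suspensionMk f s y))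

lemma suspensionι_map (A : SimplexCategory ⥤ C) {m n n' : SimplexCategory} (s : m ⟶ ⦋1⦌)
    (y : m ⟶ n) (g : n ⟶ n') :
    suspensionι A s y ≫ (suspension.obj A).map g = suspensionι A s (y ≫ g) :=
  (tensorι_map A ((smashLeft circle).map (plus.map (SSet.stdSimplex.{0}.map g))) m
    (suspensionMk s y)).trans (congrArg _ (suspensionMk_map s y g))

lemma suspensionι_app {A B : SimplexCategory ⥤ C} (f : A ⟶ B) {m n : SimplexCategory}
    (s : m ⟶ ⦋1⦌) (y : m ⟶ n) :
    suspensionι A s y ≫ (suspension.map f).app n = f.app m ≫ suspensionι B s y :=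
  tensorι_app f _ m (suspensionMk s y)

lemma suspension_hom_ext {A : SimplexCategory ⥤ C} {n : SimplexCategory} {T : C}
    {f g : (suspension.obj A).obj n ⟶ T}
    (h : ∀ {m : SimplexCategory} (s : m ⟶ ⦋1⦌) (y : m ⟶ n),
      suspensionι A s y ≫ f = suspensionι A s y ≫ g) : f = g := by
  refine tensor_hom_ext (K := (smashLeft circle).obj (plus.obj (SSet.stdSimplex.{0}.obj n)))
    fun m x ↦ ?_
  rcases eq_point_or_eq_suspensionMk x with rfl | ⟨s, y, rfl⟩
  · rw [tensorι_point]
    exact zero_comp.trans zero_comp.symm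
  · exact h s y

/-- A map out of `(ΣA)^n` is a natural family of maps indexed by the simplices of `Δ[1] × Δ[n]` that
vanishes on `∂Δ[1] × Δ[n]`. -/
lemma exists_suspension_desc {A : SimplexCategory ⥤ C} {n : SimplexCategory} {T : C}
    (h : ∀ {m : SimplexCategory} (_ : m ⟶ ⦋1⦌) (_ : m ⟶ n), A.obj m ⟶ T)
    (h0 : ∀ {m : SimplexCategory} (s : m ⟶ ⦋1⦌) (y : m ⟶ n),
      ¬ Function.Surjective s.toOrderHom → h s y = 0)
    (hf : ∀ {l m : SimplexCategory} (f : l ⟶ m) (s : m ⟶ ⦋1⦌) (y : m ⟶ n),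
      A.map f ≫ h s y = h (f ≫ s) (f ≫ y)) :
    ∃ g : (suspension.obj A).obj n ⟶ T,
      ∀ {m : SimplexCategory} (s : m ⟶ ⦋1⦌) (y : m ⟶ n), suspensionι A s y ≫ g = h s y := by
  let h' : ∀ (m : SimplexCategory)
      (_ : (((smashLeft circle).obj (plus.obj (SSet.stdSimplex.{0}.obj n))).obj (op m)).X),
      A.obj m ⟶ T := fun m x ↦ match x with
    | none => 0
    | some ⟨(none, _), _⟩ => 0
    | some ⟨(some _, none), _⟩ => 0
    | some ⟨(some s, some y), _⟩ => h (SSet.stdSimplex.objEquiv s.1) (SSet.stdSimplex.objEquiv y)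
  have h'_mk : ∀ {m : SimplexCategory} (s : m ⟶ ⦋1⦌) (y : m ⟶ n),
      h' m (suspensionMk s y) = h s y := by
    intro m s y
    by_cases hs : Function.Surjective s.toOrderHom
    · obtain ⟨_, h₂⟩ := suspensionMk_eq_some hs y
      rw [h₂]
      rfl
    · rw [suspensionMk_of_not_surjective hs, h0 s y hs]
      rfl
  refine ⟨tensorDesc (K := (smashLeft circle).obj (plus.obj (SSet.stdSimplex.{0}.obj n)))
    h' (fun _ ↦ rfl) fun {k l} f x ↦ ?_, fun s y ↦
    (tensorι_desc h' _ _ _ _).trans (h'_mk s y)⟩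
  rcases eq_point_or_eq_suspensionMk x with rfl | ⟨s, y, rfl⟩
  · exact comp_zero.trans (congrArg (h' k) (Pointed.Hom.map_point
      (((smashLeft circle).obj (plus.obj (SSet.stdSimplex.{0}.obj n))).map f.op))).symm
  · exact (congrArg (A.map f ≫ ·) (h'_mk s y)).trans ((hf f s y).trans
      ((h'_mk _ _).symm.trans (congrArg (h' k) (map_suspensionMk f s y).symm)))

end Suspension

/-! ### Simplices of the prism -/

namespace Chain

/-- The component in `Δ[1]` of a simplex of `Δ[1] × Δ[n]`. -/
abbrev fst {n : ℕ} (x : Chain (Fin 2 × Fin (n + 1))) : x.dim ⟶ ⦋1⦌ :=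
  SimplexCategory.Hom.mk (OrderHom.fst.comp x.vert)

/-- The component in `Δ[n]` of a simplex of `Δ[1] × Δ[n]`. -/
abbrev snd {n : ℕ} (x : Chain (Fin 2 × Fin (n + 1))) : x.dim ⟶ ⦋n⦌ :=
  SimplexCategory.Hom.mk (OrderHom.snd.comp x.vert)

/-- The simplex of `Δ[1] × Δ[n]` with given components. -/
abbrev prism {n : ℕ} {m : SimplexCategory} (s : m ⟶ ⦋1⦌) (y : m ⟶ ⦋n⦌) :
    Chain (Fin 2 × Fin (n + 1)) where
  dim := m
  vert := s.toOrderHom.prod y.toOrderHom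

lemma mor_fst {n : ℕ} {x x' : Chain (Fin 2 × Fin (n + 1))} (f : x ⟶ x') :
    f.mor ≫ x'.fst = x.fst := by
  ext i : 3
  exact congrArg Prod.fst (f.fac i)

lemma mor_snd {n : ℕ} {x x' : Chain (Fin 2 × Fin (n + 1))} (f : x ⟶ x') :
    f.mor ≫ x'.snd = x.snd := by
  ext i : 3
  exact congrArg Prod.snd (f.fac i)

lemma prism_fst {n : ℕ} {m : SimplexCategory} (s : m ⟶ ⦋1⦌) (y : m ⟶ ⦋n⦌) :
    (prism s y).fst = s := by
  ext i : 3
  rfl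

lemma prism_snd {n : ℕ} {m : SimplexCategory} (s : m ⟶ ⦋1⦌) (y : m ⟶ ⦋n⦌) :
    (prism s y).snd = y := by
  ext i : 3
  rfl

lemma surjective_of_comp {l m : SimplexCategory} {n : ℕ} {f : l ⟶ m} {s : m ⟶ ⦋n⦌}
    {t : l ⟶ ⦋n⦌} (h : f ≫ s = t) (ht : Function.Surjective t.toOrderHom) :
    Function.Surjective s.toOrderHom := fun i ↦ by
  subst h
  obtain ⟨j, rfl⟩ := ht i
  exact ⟨f.toOrderHom j, rfl⟩

end Chain

section Suspension

variable {C : Type u} [Category.{v} C] [HasZeroMorphisms C] [HasColimitsOfSize.{0, 0} C]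

/-- The canonical family of maps to `(ΣA)^n`. -/
abbrev suspensionFamily (A : SimplexCategory ⥤ C) (n : ℕ) :
    Family (Chain.functor A (Fin 2 × Fin (n + 1))) ⊤ ((suspension.obj A).obj ⦋n⦌) where
  hom x _ := suspensionι A x.fst x.snd
  comm f _ _ := (suspensionι_face A f.mor _ _).trans (by rw [Chain.mor_fst, Chain.mor_snd])

lemma exists_suspension_desc_family {A : SimplexCategory ⥤ C} {n : ℕ} {T : C}
    (k : Family (Chain.functor A (Fin 2 × Fin (n + 1))) ⊤ T)
    (hk : ∀ x, ¬ Function.Surjective x.fst.toOrderHom → k.hom x trivial = 0) :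
    ∃ g : (suspension.obj A).obj ⦋n⦌ ⟶ T, ∀ {m : SimplexCategory} (s : m ⟶ ⦋1⦌) (y : m ⟶ ⦋n⦌),
      suspensionι A s y ≫ g = k.hom (Chain.prism s y) trivial :=
  exists_suspension_desc (fun s y ↦ k.hom (Chain.prism s y) trivial) (fun _ _ hs ↦ hk _ hs)
    (fun f s y ↦ k.comm (show Chain.prism (f ≫ s) (f ≫ y) ⟶ Chain.prism s y from
      ⟨f, fun _ ↦ rfl⟩) trivial trivial)

variable [ModelCategory C]

/-- The lifting problem for the latching map of `ΣA` in degree `n` is a lifting problem for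
families on the simplices of `Δ[1] × Δ[n]` which are prescribed on the boundary of the prism. -/
lemma isReedyCofibrant_suspension {A : SimplexCategory ⥤ C} (hA : IsReedyCofibrant A) :
    IsReedyCofibrant (suspension.obj A) := by
  classical
  rw [isReedyCofibrant_iff]
  intro n Z W p _ _ h g hg
  have hcomm : ∀ {e e' : Chain (Fin (n + 1))} (f : e ⟶ e') he he',
      (suspension.obj A).map f.mor ≫ h.hom e' he' = h.hom e he := h.comm
  have hg' : ∀ e he, (suspension.obj A).map (Chain.toMor e) ≫ g =
      h.hom e he ≫ p := fun e he ↦ hg e ((Chain.isTerminalTop n).from e) he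
  let F : ObjectProperty (Chain (Fin 2 × Fin (n + 1))) := fun x ↦
    ¬ Function.Surjective x.fst.toOrderHom ∨ ¬ Function.Surjective x.snd.toOrderHom
  have hF : IsLower F := by
    rintro x x' f (h | h)
    · exact Or.inl fun h' ↦ h (Chain.surjective_of_comp (Chain.mor_fst f) h')
    · exact Or.inr fun h' ↦ h (Chain.surjective_of_comp (Chain.mor_snd f) h')
  let k : Family (Chain.functor A (Fin 2 × Fin (n + 1))) F Z :=
    { hom := fun x _ ↦ if hx : ¬ Function.Surjective x.snd.toOrderHom then
        suspensionι A x.fst (𝟙 x.dim) ≫ h.hom (Chain.ofMor x.snd) hx else 0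
      comm := fun {x x'} f hx hx' ↦ by
        by_cases h' : ¬ Function.Surjective x'.snd.toOrderHom
        · have h'' : ¬ Function.Surjective x.snd.toOrderHom :=
            fun h'' ↦ h' (Chain.surjective_of_comp (Chain.mor_snd f) h'')
          rw [dif_pos h', dif_pos h'', reassoc_of% (suspensionι_face A f.mor), Chain.mor_fst,
            ← hcomm (show Chain.ofMor x.snd ⟶ Chain.ofMor x'.snd from
              ⟨f.mor, fun i ↦ congrArg Prod.snd (f.fac i)⟩) h'' h',
            reassoc_of% (suspensionι_map A x.fst (𝟙 x.dim) f.mor), Category.comp_id]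
        · rw [dif_neg h', comp_zero]
          split_ifs with h''
          · rfl
          · rw [suspensionι_of_not_surjective A fun h₁ ↦ (hx'.resolve_right h')
              (Chain.surjective_of_comp (Chain.mor_fst f) h₁), zero_comp] }
  obtain ⟨k', h₁, h₂⟩ := hA.hasExtension hF p k ((suspensionFamily A n).comp g) (by
    intro x hx _
    change (dite _ _ _) ≫ p = suspensionι A x.fst x.snd ≫ g
    split_ifs with h'
    · rw [zero_comp, suspensionι_of_not_surjective A (hx.resolve_right (not_not.2 h')), zero_comp]
    · rw [Category.assoc, ← hg' (Chain.ofMor x.snd) h']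
      exact (reassoc_of% (suspensionι_map A x.fst (𝟙 x.dim) x.snd)) g)
  obtain ⟨d, hd⟩ := exists_suspension_desc_family k' fun x hx ↦ by
    rw [h₁ x (Or.inl hx)]
    change dite _ _ _ = _
    split_ifs
    · rfl
    · rw [suspensionι_of_not_surjective A hx, zero_comp]
  refine ⟨d, fun e u he ↦ suspension_hom_ext fun {m} s y ↦ ?_,
    suspension_hom_ext fun {m} s y ↦ ?_⟩
  · change suspensionι A s y ≫ (suspension.obj A).map u.mor ≫ d = _
    rw [reassoc_of% (suspensionι_map A s y u.mor), hd]
    have hs : ¬ Function.Surjective (Chain.prism s (y ≫ u.mor)).snd.toOrderHom :=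
      (fun h' ↦ he fun i ↦ by
        obtain ⟨j, hj⟩ := h' i
        exact ⟨y.toOrderHom j, (u.fac _).symm.trans hj⟩)
    refine (h₁ _ (Or.inr hs) trivial).trans ((dif_pos hs).trans ?_)
    have h₃ : (suspension.obj A).map y ≫ h.hom e he =
        h.hom (Chain.ofMor (Chain.prism s (y ≫ u.mor)).snd) hs :=
      hcomm (Chain.Hom.mk (e := Chain.ofMor (Chain.prism s (y ≫ u.mor)).snd) (e' := e) y
        fun i ↦ (u.fac (y.toOrderHom i)).symm) hs he
    refine (congrArg (suspensionι A · (𝟙 m) ≫ _) (Chain.prism_fst s (y ≫ u.mor))).trans ?_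
    refine (congrArg (suspensionι A s (𝟙 m) ≫ ·) h₃.symm).trans ?_
    exact (reassoc_of% (suspensionι_map A s (𝟙 m) y)) _
  · rw [reassoc_of% (hd s y)]
    refine (h₂ (Chain.prism s y) trivial).trans ?_
    change suspensionι A (Chain.prism s y).fst (Chain.prism s y).snd ≫ g = _
    rw [Chain.prism_fst, Chain.prism_snd]

end Suspension

/-! ### Collapsing prisms -/

section Cells

variable {C : Type u} [Category.{v} C]

/-- Attaching a simplex `e` along a single face `e₀`. -/
lemma cellLift_of_face {A : SimplexCategory ⥤ C} {Q : Type} [PartialOrder Q]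
    {F : ObjectProperty (Chain Q)} {e e₀ : Chain Q} (he : e.Nondegenerate) (v : e₀ ⟶ e)
    (h₀ : F e₀) (hF : ∀ e', F e' → ∀ _ : e' ⟶ e, Nonempty (e' ⟶ e₀)) {Z W : C} (p : Z ⟶ W)
    [HasLiftingProperty (A.map v.mor) p] : CellLift (Chain.functor A Q) F e p := by
  intro k g hg
  have hcomm : ∀ {e e' : Chain Q} (f : e ⟶ e') he he', A.map f.mor ≫ k.hom e' he' = k.hom e he :=
    k.comm
  obtain ⟨d, h₁, h₂⟩ := exists_lift (A.map v.mor) p (hg e₀ v h₀).symm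
  refine ⟨d, fun e' u he' ↦ ?_, h₂⟩
  obtain ⟨w⟩ := hF e' he' u
  have hu : u.mor = w.mor ≫ v.mor := congrArg Chain.Hom.mor ((he.subsingleton e').elim u (w ≫ v))
  change A.map u.mor ≫ d = _
  rw [hu, A.map_comp, Category.assoc, h₁, hcomm]

/-- If families on the faces of `e` extend to `G`, then the map from `X e` to the colimit over `G`
has a lifting property: the colimit over the faces of `e` is `X e`. -/
lemma HasExtension.hasLiftingProperty_ι {E : Type} [SmallCategory E] [HasColimitsOfSize.{0, 0} C]
    {X : E ⥤ C} {G : ObjectProperty E} {e : E} (he : ∀ e', Subsingleton (e' ⟶ e)) (hG : G e)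
    {F : ObjectProperty E} (hF : ∀ e', F e' ↔ Nonempty (e' ⟶ e)) {Z W : C}
    {p : Z ⟶ W} (h : HasExtension X F G p) :
    HasLiftingProperty ((familyColimit.ι X G).hom e hG) p := by
  refine hasLiftingProperty_of_exists fun a b hab ↦ ?_
  obtain ⟨k, h₁, h₂⟩ := h
    { hom := fun e' he' ↦ X.map ((hF e').1 he').some ≫ a
      comm := fun {e' e''} f he' he'' ↦ by
        rw [← X.map_comp_assoc]
        congr 2
        exact (he e').elim _ _ } ((familyColimit.ι X G).comp b)
    (fun e' he' he'' ↦ by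
      rw [Category.assoc, hab, Family.comp_hom, ← Category.assoc, (familyColimit.ι X G).comm])
  refine ⟨k.desc, ?_, familyColimit.hom_ext fun e' he' ↦ ?_⟩
  · rw [Family.ι_desc, h₁ e ((hF e).2 ⟨𝟙 e⟩)]
    dsimp only
    rw [(he e).elim ((hF e).1 ((hF e).2 ⟨𝟙 e⟩)).some (𝟙 e), X.map_id, Category.id_comp]
  · rw [reassoc_of% (k.ι_desc e' he'), h₂, Family.comp_hom]

lemma hasExtension_of_hasLiftingProperty {E : Type} [SmallCategory E] [HasColimitsOfSize.{0, 0} C]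
    {X : E ⥤ C} {F G : ObjectProperty E} (hFG : F ≤ G) {Z W : C} (p : Z ⟶ W)
    [HasLiftingProperty ((familyColimit.ι X G).restrict hFG).desc p] : HasExtension X F G p := by
  intro k l hkl
  obtain ⟨d, h₁, h₂⟩ := exists_lift ((familyColimit.ι X G).restrict hFG).desc p
    (a := k.desc) (b := l.desc) (familyColimit.hom_ext fun e he ↦ by
      rw [reassoc_of% (k.ι_desc e he), reassoc_of% (Family.ι_desc _ e he), Family.restrict_hom,
        Family.ι_desc, hkl])
  refine ⟨(familyColimit.ι X G).comp d, fun e he he' ↦ ?_, fun e he ↦ ?_⟩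
  · rw [← k.ι_desc e he, ← h₁, reassoc_of% (Family.ι_desc _ e he)]
    rfl
  · rw [Family.comp_hom, Category.assoc, h₂, Family.ι_desc]

end Cells

namespace Chain

/-- The maximal simplices `(0,0) < ⋯ < (0,j) < (1,j) < ⋯ < (1,n)` of the prism. -/
abbrev shuffle {n : ℕ} (j : Fin (n + 1)) : Chain (Fin 2 × Fin (n + 1)) where
  dim := ⦋n + 1⦌
  vert :=
    { toFun i := (if i ≤ j.castSucc then 0 else 1, j.predAbove i)
      monotone' a b h := by
        refine ⟨?_, Fin.predAbove_right_monotone j h⟩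
        dsimp only
        split_ifs with h₁ h₂
        · rfl
        · exact Fin.zero_le _
        · exact absurd (h.trans ‹_›) h₁
        · rfl }

lemma shuffle_vert_of_le {n : ℕ} {j : Fin (n + 1)} {a : Fin (n + 1)} (h : a ≤ j) :
    (shuffle j).vert a.castSucc = (0, a) :=
  Prod.ext (if_pos (Fin.castSucc_le_castSucc_iff.2 h)) (Fin.predAbove_castSucc_of_le _ _ h)

lemma shuffle_vert_of_ge {n : ℕ} {j : Fin (n + 1)} {a : Fin (n + 1)} (h : j ≤ a) :
    (shuffle j).vert a.succ = (1, a) :=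
  Prod.ext (if_neg (not_le.2 (Fin.castSucc_lt_succ_iff.2 h))) (Fin.predAbove_succ_of_le _ _ h)

lemma shuffle_vert_cases {n : ℕ} (j : Fin (n + 1)) (i : Fin (n + 2)) :
    (∃ a ≤ j, i = a.castSucc) ∨ ∃ a, j ≤ a ∧ i = a.succ := by
  rcases le_or_gt i j.castSucc with h | h
  · obtain ⟨a, rfl⟩ := Fin.eq_castSucc_of_ne_last (x := i)
      (h.trans_lt (Fin.castSucc_lt_last j)).ne
    exact Or.inl ⟨a, Fin.castSucc_le_castSucc_iff.1 h, rfl⟩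
  · obtain ⟨a, rfl⟩ := Fin.eq_succ_of_ne_zero (i := i) (ne_of_gt ((Fin.zero_le _).trans_lt h))
    exact Or.inr ⟨a, Fin.castSucc_lt_succ_iff.1 h, rfl⟩

lemma nondegenerate_shuffle {n : ℕ} (j : Fin (n + 1)) : (shuffle j).Nondegenerate := by
  intro i i' h
  rcases shuffle_vert_cases j i with ⟨a, ha, rfl⟩ | ⟨a, ha, rfl⟩ <;>
  rcases shuffle_vert_cases j i' with ⟨b, hb, rfl⟩ | ⟨b, hb, rfl⟩
  · rw [(Prod.mk.inj ((shuffle_vert_of_le ha).symm.trans (h.trans (shuffle_vert_of_le hb)))).2]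
  · exact absurd (Prod.mk.inj ((shuffle_vert_of_le ha).symm.trans
      (h.trans (shuffle_vert_of_ge hb)))).1 (by decide)
  · exact absurd (Prod.mk.inj ((shuffle_vert_of_ge ha).symm.trans
      (h.trans (shuffle_vert_of_le hb)))).1 (by decide)
  · rw [(Prod.mk.inj ((shuffle_vert_of_ge ha).symm.trans (h.trans (shuffle_vert_of_ge hb)))).2]

lemma mem_range_shuffle {n : ℕ} {j : Fin (n + 1)} {q : Fin 2 × Fin (n + 1)} :
    q ∈ (shuffle j).range ↔ (q.1 = 0 ∧ q.2 ≤ j) ∨ (q.1 = 1 ∧ j ≤ q.2) := by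
  constructor
  · rintro ⟨i, rfl⟩
    rcases shuffle_vert_cases j i with ⟨a, ha, rfl⟩ | ⟨a, ha, rfl⟩
    · rw [shuffle_vert_of_le ha]
      exact Or.inl ⟨rfl, ha⟩
    · rw [shuffle_vert_of_ge ha]
      exact Or.inr ⟨rfl, ha⟩
  · obtain ⟨q₁, q₂⟩ := q
    rintro (⟨rfl, h⟩ | ⟨rfl, h⟩)
    · exact ⟨_, shuffle_vert_of_le h⟩
    · exact ⟨_, shuffle_vert_of_ge h⟩

/-- The subcomplex of the prism generated by `{0} × Δ[n]` and by the shuffles from `j` on. -/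
def shuffleFiltration (n j : ℕ) : ObjectProperty (Chain (Fin 2 × Fin (n + 1))) := fun x ↦
  (∀ q ∈ x.range, q.1 = 0) ∨ ∃ i : Fin (n + 1), j ≤ i ∧ x.range ⊆ (shuffle i).range

lemma isLower_shuffleFiltration (n j : ℕ) : IsLower (shuffleFiltration n j) := by
  rintro x x' f (h | ⟨i, hi, h⟩)
  · exact Or.inl fun q hq ↦ h q (range_subset f hq)
  · exact Or.inr ⟨i, hi, (range_subset f).trans h⟩

lemma shuffleFiltration_zero (n : ℕ) : shuffleFiltration n 0 = ⊤ := by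
  refine top_unique fun x _ ↦ ?_
  by_cases h : ∃ i, (x.vert i).1 ≠ 0
  · right
    obtain ⟨i, hi, hmin⟩ := exists_minimalFor_of_wellFoundedLT (fun i ↦ (x.vert i).1 ≠ 0) id h
    refine ⟨(x.vert i).2, Nat.zero_le _, ?_⟩
    rintro _ ⟨i', rfl⟩
    rw [mem_range_shuffle]
    by_cases h' : (x.vert i').1 = 0
    · refine Or.inl ⟨h', (x.vert.monotone ?_).2⟩
      by_contra hlt
      have h₁ := (x.vert.monotone (not_le.1 hlt).le).1
      rw [h'] at h₁
      exact hi (le_antisymm h₁ (Fin.zero_le _))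
    · refine Or.inr ⟨by omega, (x.vert.monotone ?_).2⟩
      rcases le_total i i' with h₁ | h₁
      · exact h₁
      · exact hmin h' h₁
  · refine Or.inl ?_
    rintro _ ⟨i, rfl⟩
    by_contra h'
    exact h ⟨i, h'⟩

end Chain

section Prism

variable {C : Type u} [Category.{v} C] [ModelCategory C]

lemma weakEquivalence_map {A : SimplexCategory ⥤ C}
    (hδ : ∀ (n : ℕ) (i : Fin (n + 2)), WeakEquivalence (A.map (SimplexCategory.δ i)))
    (hσ : ∀ (n : ℕ) (i : Fin (n + 1)), WeakEquivalence (A.map (SimplexCategory.σ i)))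
    {m n : SimplexCategory} (f : m ⟶ n) : WeakEquivalence (A.map f) := by
  have h := SimplexCategory.morphismProperty_eq_top
    ((weakEquivalences C).inverseImage A)
    (fun {n} i ↦ (weakEquivalence_iff _).1 (hδ n i))
    (fun {n} i ↦ (weakEquivalence_iff _).1 (hσ n i))
  have h' : (weakEquivalences C).inverseImage A f := by
    rw [h]
    trivial
  exact (weakEquivalence_iff _).2 h'

variable [HasZeroMorphisms C] [HasColimitsOfSize.{0, 0} C]

lemma IsCosimplicialResolution.weakEquivalence_map {A : SimplexCategory ⥤ C}
    (hA : IsCosimplicialResolution A) {m n : SimplexCategory} (f : m ⟶ n) :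
    WeakEquivalence (A.map f) :=
  CosimplicialResolutions.weakEquivalence_map hA.weakEquivalence_coface
    hA.weakEquivalence_codegeneracy f

/-- Structure maps of a cosimplicial resolution along monomorphisms are trivial cofibrations. -/
lemma IsCosimplicialResolution.hasLiftingProperty_map {A : SimplexCategory ⥤ C}
    (hA : IsCosimplicialResolution A) {m : SimplexCategory} {n : ℕ} (f : m ⟶ ⦋n⦌) [Mono f]
    {Z W : C} (p : Z ⟶ W) [Fibration p] : HasLiftingProperty (A.map f) p := by
  have := hA.weakEquivalence_map f
  have := hA.reedyCofibrant.cofibration_map f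
  infer_instance

lemma Chain.Nondegenerate.mono {Q : Type} [PartialOrder Q] {e e' : Chain Q}
    (he : e.Nondegenerate) (f : e ⟶ e') : Mono f.mor := by
  rw [SimplexCategory.mono_iff_injective]
  intro a b h
  exact he ((f.fac a).symm.trans ((congrArg e'.vert h).trans (f.fac b)))

/-- The prism is built up from `{0} × Δ[n]` by attaching the shuffles in the order `j = n, …, 0`,
each of them along its face opposite to the vertex `(1, j)`. -/
lemma IsCosimplicialResolution.hasExtension_shuffleFiltration {A : SimplexCategory ⥤ C}
    (hA : IsCosimplicialResolution A) (n : ℕ) {Z W : C} (p : Z ⟶ W) [Fibration p] (k j : ℕ)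
    (hj : j + k = n + 1) :
    HasExtension (Chain.functor A (Fin 2 × Fin (n + 1))) (fun x ↦ ∀ q ∈ x.range, q.1 = 0)
      (Chain.shuffleFiltration n j) p := by
  induction k generalizing j with
  | zero =>
    have : Chain.shuffleFiltration n j = fun x ↦ ∀ q ∈ x.range, q.1 = 0 := by
      ext x
      refine ⟨?_, Or.inl⟩
      rintro (h | ⟨i, hi, -⟩)
      · exact h
      · omega
    rw [this]
    exact .refl _ _
  | succ k ih =>
    have hjn : j < n + 1 := by omega
    let e := Chain.shuffle (⟨j, hjn⟩ : Fin (n + 1))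
    have he : e.Nondegenerate := Chain.nondegenerate_shuffle _
    -- the face of the shuffle opposite to the vertex `(1, j)`
    let e₀ := e.pull (SimplexCategory.δ (n := n) (Fin.succ ⟨j, hjn⟩))
    have he₀ : ∀ q, q ∈ e₀.range ↔ q ∈ e.range ∧ q ≠ (1, ⟨j, hjn⟩) := by
      intro q
      constructor
      · rintro ⟨i, rfl⟩
        refine ⟨⟨_, rfl⟩, fun h ↦ ?_⟩
        rw [← Chain.shuffle_vert_of_ge (le_refl (⟨j, hjn⟩ : Fin (n + 1)))] at h
        exact Fin.succAbove_ne _ _ (he h)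
      · rintro ⟨⟨i, rfl⟩, h⟩
        obtain ⟨i', rfl⟩ := Fin.exists_succAbove_eq (y := Fin.succ ⟨j, hjn⟩) (x := i) (by
          rintro rfl
          exact h (Chain.shuffle_vert_of_ge le_rfl))
        exact ⟨i', rfl⟩
    have he₀' : e₀.Nondegenerate := fun a b h ↦ Fin.succAbove_right_injective (he h)
    have h₀ : Chain.shuffleFiltration n (j + 1) e₀ := by
      by_cases hjn' : j = n
      · left
        intro q hq
        obtain ⟨h₁, h₂⟩ := (he₀ q).1 hq
        rcases Chain.mem_range_shuffle.1 h₁ with ⟨h₃, -⟩ | ⟨h₃, h₄⟩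
        · exact h₃
        · refine (h₂ (Prod.ext h₃ (le_antisymm ?_ h₄))).elim
          rw [Fin.le_def]
          dsimp only
          omega
      · right
        refine ⟨⟨j + 1, by omega⟩, le_rfl, fun q hq ↦ ?_⟩
        obtain ⟨h₁, h₂⟩ := (he₀ q).1 hq
        rw [Chain.mem_range_shuffle]
        rcases Chain.mem_range_shuffle.1 h₁ with ⟨h₃, h₄⟩ | ⟨h₃, h₄⟩
        · exact Or.inl ⟨h₃, h₄.trans (Nat.le_succ j)⟩
        · refine Or.inr ⟨h₃, ?_⟩
          exact lt_of_le_of_ne h₄ fun h ↦ h₂ (Prod.ext h₃ h.symm)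
    have hmono : Chain.shuffleFiltration n (j + 1) ≤ Chain.shuffleFiltration n j := by
      rintro x (h | ⟨i, hi, h⟩)
      · exact Or.inl h
      · exact Or.inr ⟨i, by omega, h⟩
    refine (ih (j + 1) (by omega)).trans ?_ (fun _ ↦ Or.inl) hmono
    have : Mono (e.pullHom (SimplexCategory.δ (n := n) (Fin.succ ⟨j, hjn⟩))).mor :=
      he₀'.mono _
    have := hA.hasLiftingProperty_map (n := n + 1)
      (e.pullHom (SimplexCategory.δ (n := n) (Fin.succ ⟨j, hjn⟩))).mor p
    refine (cellLift_of_face he (e.pullHom (SimplexCategory.δ (n := n) (Fin.succ ⟨j, hjn⟩))) h₀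
      (fun e' h u ↦ he₀'.nonempty_hom fun q hq ↦ (he₀ q).2
        ⟨Chain.range_subset u hq, ?_⟩) p).hasExtension (Chain.isLower_shuffleFiltration _ _)
      he.subsingleton hmono (Or.inr ⟨⟨j, hjn⟩, le_rfl, le_rfl⟩) ?_
    · rintro rfl
      rcases h with h | ⟨i, hi, h⟩
      · exact absurd (h _ hq) (by simp)
      · rcases Chain.mem_range_shuffle.1 (h hq) with ⟨h, -⟩ | ⟨-, h⟩
        · exact absurd h (by simp)
        · rw [Fin.le_def] at h
          dsimp only at h
          omega
    · rintro x (h | ⟨i, hi, h⟩)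
      · exact Or.inl (Or.inl h)
      · rcases hi.eq_or_lt with h' | h'
        · right
          obtain rfl : i = ⟨j, hjn⟩ := Fin.ext h'.symm
          exact he.nonempty_hom h
        · exact Or.inl (Or.inr ⟨i, h', h⟩)

end Prism

/-! ### The suspension of a cosimplicial resolution -/

namespace Chain

/-- The edge `Δ[1] × {0}` of the prism. -/
abbrev bottomEdge (n : ℕ) : Chain (Fin 2 × Fin (n + 1)) where
  dim := ⦋1⦌
  vert := { toFun i := (i, 0), monotone' _ _ h := ⟨h, le_rfl⟩ }

/-- The face `{a} × Δ[n]` of the prism. -/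
abbrev side (n : ℕ) (a : Fin 2) : Chain (Fin 2 × Fin (n + 1)) where
  dim := ⦋n⦌
  vert := { toFun i := (a, i), monotone' _ _ h := ⟨le_rfl, h⟩ }

/-- The vertex `(a, 0)` of the prism. -/
abbrev corner (n : ℕ) (a : Fin 2) : Chain (Fin 2 × Fin (n + 1)) where
  dim := ⦋0⦌
  vert := { toFun _ := (a, 0), monotone' _ _ _ := le_rfl }

/-- The vertex `(a, 0)` as the initial vertex of the face `{a} × Δ[n]`. -/
abbrev cornerToSide (n : ℕ) (a : Fin 2) : corner n a ⟶ side n a :=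
  ⟨SimplexCategory.const ⦋0⦌ ⦋n⦌ 0, fun _ ↦ rfl⟩

/-- The vertex `(a, 0)` as the vertex `a` of the edge `Δ[1] × {0}`. -/
abbrev cornerToBottomEdge (n : ℕ) (a : Fin 2) : corner n a ⟶ bottomEdge n :=
  ⟨SimplexCategory.const ⦋0⦌ ⦋1⦌ a, fun _ ↦ rfl⟩

lemma nondegenerate_bottomEdge (n : ℕ) : (bottomEdge n).Nondegenerate :=
  fun _ _ h ↦ (Prod.mk.inj h).1

lemma nondegenerate_side (n : ℕ) (a : Fin 2) : (side n a).Nondegenerate :=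
  fun _ _ h ↦ (Prod.mk.inj h).2

lemma nondegenerate_corner (n : ℕ) (a : Fin 2) : (corner n a).Nondegenerate :=
  fun _ _ _ ↦ Subsingleton.elim (α := Fin 1) _ _

lemma nonempty_hom_bottomEdge_iff {n : ℕ} (x : Chain (Fin 2 × Fin (n + 1))) :
    Nonempty (x ⟶ bottomEdge n) ↔ ∀ q ∈ x.range, q.2 = 0 := by
  refine ⟨fun ⟨f⟩ q hq ↦ ?_, fun h ↦ (nondegenerate_bottomEdge n).nonempty_hom fun q hq ↦
    ⟨q.1, Prod.ext rfl (h q hq).symm⟩⟩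
  obtain ⟨i, rfl⟩ := range_subset f hq
  rfl

lemma nonempty_hom_side_iff {n : ℕ} {a : Fin 2} (x : Chain (Fin 2 × Fin (n + 1))) :
    Nonempty (x ⟶ side n a) ↔ ∀ q ∈ x.range, q.1 = a := by
  refine ⟨fun ⟨f⟩ q hq ↦ ?_, fun h ↦ (nondegenerate_side n a).nonempty_hom fun q hq ↦
    ⟨q.2, Prod.ext (h q hq).symm rfl⟩⟩
  obtain ⟨i, rfl⟩ := range_subset f hq
  rfl

lemma not_surjective_fst_iff {n : ℕ} (x : Chain (Fin 2 × Fin (n + 1))) :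
    ¬ Function.Surjective x.fst.toOrderHom ↔ ∃ a, ∀ q ∈ x.range, q.1 = a := by
  constructor
  · intro h
    obtain ⟨b, hb⟩ := not_forall.1 h
    refine ⟨1 - b, ?_⟩
    rintro _ ⟨i, rfl⟩
    have h₁ : (x.vert i).1 ≠ b := fun h' ↦ hb ⟨i, h'⟩
    omega
  · rintro ⟨a, ha⟩ h
    obtain ⟨i, hi⟩ := h (1 - a)
    have h₁ : (x.vert i).1 = a := ha _ ⟨i, rfl⟩
    have h₂ : (x.vert i).1 = 1 - a := hi
    omega

/-- The subcomplex `Δ[1] × {0} ∪ ∂Δ[1] × Δ[n]` of the prism. -/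
def openBox (n : ℕ) : ObjectProperty (Chain (Fin 2 × Fin (n + 1))) :=
  fun x ↦ (∀ q ∈ x.range, q.2 = 0) ∨ ¬ Function.Surjective x.fst.toOrderHom

lemma isLower_openBox (n : ℕ) : IsLower (openBox n) := by
  rintro x x' f (h | h)
  · exact Or.inl fun q hq ↦ h q (range_subset f hq)
  · exact Or.inr fun h' ↦ h (surjective_of_comp (mor_fst f) h')

end Chain

section

variable {C : Type u} [Category.{v} C] [HasZeroMorphisms C] [HasColimitsOfSize.{0, 0} C]
  [ModelCategory C] {A : SimplexCategory ⥤ C}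

/-- The side `{a} × Δ[n]` is attached along the vertex `(a, 0)`, provided that `F` meets this side in
that vertex only. -/
lemma IsCosimplicialResolution.cellLift_side (hA : IsCosimplicialResolution A) (n : ℕ) (a : Fin 2)
    {F : ObjectProperty (Chain (Fin 2 × Fin (n + 1)))} (h₀ : F (Chain.corner n a))
    (hF : ∀ x, F x → (∀ q ∈ x.range, q.1 = a) → ∀ q ∈ x.range, q.2 = 0) {Z W : C} (p : Z ⟶ W)
    [Fibration p] : CellLift (Chain.functor A _) F (Chain.side n a) p := by
  have : Mono (Chain.cornerToSide n a).mor := (Chain.nondegenerate_corner n a).mono _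
  have := hA.hasLiftingProperty_map (n := n) (Chain.cornerToSide n a).mor p
  refine cellLift_of_face (Chain.nondegenerate_side n a) (Chain.cornerToSide n a) h₀
    (fun x hx u ↦ (Chain.nondegenerate_corner n a).nonempty_hom fun q hq ↦ ?_) p
  have h₁ := (Chain.nonempty_hom_side_iff x).1 ⟨u⟩
  exact ⟨0, Prod.ext (h₁ q hq).symm (hF x hx h₁ q hq).symm⟩

/-- The sides `{0} × Δ[n]` and `{1} × Δ[n]` are attached to the edge `Δ[1] × {0}` along vertices. -/
lemma IsCosimplicialResolution.hasExtension_openBox (hA : IsCosimplicialResolution A) (n : ℕ)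
    {Z W : C} (p : Z ⟶ W) [Fibration p] :
    HasExtension (Chain.functor A (Fin 2 × Fin (n + 1))) (fun x ↦ ∀ q ∈ x.range, q.2 = 0)
      (Chain.openBox n) p := by
  have hcorner : ∀ a, ∀ q ∈ (Chain.corner n a).range, q.2 = 0 := by
    rintro a _ ⟨i, rfl⟩
    rfl
  let F : ObjectProperty (Chain (Fin 2 × Fin (n + 1))) :=
    fun x ↦ (∀ q ∈ x.range, q.2 = 0) ∨ ∀ q ∈ x.range, q.1 = 0
  have hF : IsLower F := by
    rintro x x' f (h | h)
    · exact Or.inl fun q hq ↦ h q (Chain.range_subset f hq)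
    · exact Or.inr fun q hq ↦ h q (Chain.range_subset f hq)
  have hF' : F ≤ Chain.openBox n := by
    rintro x (h | h)
    · exact Or.inl h
    · exact Or.inr ((Chain.not_surjective_fst_iff x).2 ⟨0, h⟩)
  refine HasExtension.trans (G := F) ?_ ?_ (fun _ ↦ Or.inl) hF'
  · refine (hA.cellLift_side n 0 (hcorner 0) (fun x hx _ ↦ hx) p).hasExtension
      (fun x x' f h q hq ↦ h q (Chain.range_subset f hq))
      (Chain.nondegenerate_side n 0).subsingleton (fun _ ↦ Or.inl) (Or.inr ?_) ?_
    · rintro _ ⟨i, rfl⟩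
      rfl
    · exact fun x hx ↦ hx.imp_right (Chain.nonempty_hom_side_iff x).2
  · refine (hA.cellLift_side n 1 (F := F) (Or.inl (hcorner 1)) (fun x hx hx' ↦ hx.resolve_right
      fun h ↦ ?_) p).hasExtension hF
      (Chain.nondegenerate_side n 1).subsingleton hF' (Or.inr ?_) ?_
    · exact absurd ((h _ ⟨0, rfl⟩).symm.trans (hx' _ ⟨0, rfl⟩)) (by decide)
    · rw [Chain.not_surjective_fst_iff]
      refine ⟨1, ?_⟩
      rintro _ ⟨i, rfl⟩
      rfl
    · rintro x (h | h)
      · exact Or.inl (Or.inl h)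
      · obtain ⟨a, ha⟩ := (Chain.not_surjective_fst_iff x).1 h
        obtain rfl | rfl : a = 0 ∨ a = 1 := by omega
        · exact Or.inl (Or.inr ha)
        · exact Or.inr ((Chain.nonempty_hom_side_iff x).2 ha)

/-- The inclusion of the open box into the prism induces a trivial cofibration. It is compared with
the inclusions of an edge and of the bottom, which are built from faces. -/
lemma IsCosimplicialResolution.hasExtension_openBox_top (hA : IsCosimplicialResolution A) (n : ℕ)
    {Z W : C} (p : Z ⟶ W) [Fibration p] :
    HasExtension (Chain.functor A (Fin 2 × Fin (n + 1))) (Chain.openBox n) ⊤ p := by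
  let X := Chain.functor A (Fin 2 × Fin (n + 1))
  have hbox : Chain.openBox n (Chain.bottomEdge n) := Or.inl (by
    rintro _ ⟨i, rfl⟩
    rfl)
  have h₁ : WeakEquivalence ((familyColimit.ι X ⊤).hom (Chain.side n 0) trivial) :=
    (trivialCofibration_of_hasLiftingProperty fun p _ ↦
      HasExtension.hasLiftingProperty_ι (Chain.nondegenerate_side n 0).subsingleton _
        (fun x ↦ (Chain.nonempty_hom_side_iff x).symm) (by
          rw [← Chain.shuffleFiltration_zero]
          exact hA.hasExtension_shuffleFiltration n p (n + 1) 0 (Nat.zero_add _))).2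
  have h₂ : WeakEquivalence ((familyColimit.ι X (Chain.openBox n)).hom (Chain.bottomEdge n) hbox) :=
    (trivialCofibration_of_hasLiftingProperty fun p _ ↦
      HasExtension.hasLiftingProperty_ι (Chain.nondegenerate_bottomEdge n).subsingleton _
        (fun x ↦ (Chain.nonempty_hom_bottomEdge_iff x).symm) (hA.hasExtension_openBox n p)).2
  have h₃ : WeakEquivalence ((familyColimit.ι X ⊤).hom (Chain.bottomEdge n) trivial) := by
    have h₄ : WeakEquivalence ((familyColimit.ι X ⊤).hom (Chain.corner n 0) trivial) := by
      have := hA.weakEquivalence_map (Chain.cornerToSide n 0).mor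
      have h₅ : A.map (Chain.cornerToSide n 0).mor ≫
          (familyColimit.ι X ⊤).hom (Chain.side n 0) trivial = _ :=
        (familyColimit.ι X ⊤).comm (Chain.cornerToSide n 0) trivial trivial
      rw [← h₅]
      infer_instance
    have := hA.weakEquivalence_map (Chain.cornerToBottomEdge n 0).mor
    exact weakEquivalence_of_precomp_of_fac
      ((familyColimit.ι X ⊤).comm (Chain.cornerToBottomEdge n 0) trivial trivial)
  let q := ((familyColimit.ι X ⊤).restrict (le_top : Chain.openBox n ≤ ⊤)).desc
  have h₆ : (familyColimit.ι X (Chain.openBox n)).hom (Chain.bottomEdge n) hbox ≫ q =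
      (familyColimit.ι X ⊤).hom (Chain.bottomEdge n) trivial := Family.ι_desc _ _ hbox
  have : WeakEquivalence q := weakEquivalence_of_precomp_of_fac h₆
  have : Cofibration q := cofibration_of_hasLiftingProperty fun p _ _ ↦
    HasExtension.hasLiftingProperty le_top
      (hA.reedyCofibrant.hasExtension (Chain.isLower_openBox n) p)
  exact hasExtension_of_hasLiftingProperty le_top p

/-- A lifting problem for `(ΣA)⁰ ⟶ (ΣA)ⁿ` is a lifting problem for families on the prism that are
prescribed on the open box: zero on the sides, and the given map on the edge. -/
lemma IsCosimplicialResolution.weakEquivalence_suspension_const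
    (hA : IsCosimplicialResolution A) (n : ℕ) :
    WeakEquivalence ((suspension.obj A).map (SimplexCategory.const ⦋0⦌ ⦋n⦌ 0)) := by
  classical
  refine (trivialCofibration_of_hasLiftingProperty fun {Z W} p _ ↦
    hasLiftingProperty_of_exists fun a b hab ↦ ?_).2
  let t (m : SimplexCategory) : m ⟶ ⦋0⦌ := SimplexCategory.const m ⦋0⦌ 0
  have ht : ∀ {m : SimplexCategory} (f : m ⟶ ⦋0⦌), f = t m := fun {m} f ↦ by
    ext i : 3
    exact Subsingleton.elim (α := Fin 1) _ _
  let k : Family (Chain.functor A (Fin 2 × Fin (n + 1))) (Chain.openBox n) Z :=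
    { hom := fun x _ ↦ if ∀ q ∈ x.range, q.2 = 0 then suspensionι A x.fst (t x.dim) ≫ a else 0
      comm := fun {x x'} f hx hx' ↦ by
        by_cases h' : ∀ q ∈ x'.range, q.2 = 0
        · have h'' : ∀ q ∈ x.range, q.2 = 0 := fun q hq ↦ h' q (Chain.range_subset f hq)
          rw [if_pos h', if_pos h'', reassoc_of% (suspensionι_face A f.mor), Chain.mor_fst,
            ht (f.mor ≫ t x'.dim)]
        · rw [if_neg h', comp_zero]
          split_ifs with h''
          · rw [suspensionι_of_not_surjective A fun h₁ ↦ (hx'.resolve_left h')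
              (Chain.surjective_of_comp (Chain.mor_fst f) h₁), zero_comp]
          · rfl }
  obtain ⟨k', h₁, h₂⟩ := hA.hasExtension_openBox_top n p k ((suspensionFamily A n).comp b) (by
    intro x hx _
    change (ite _ _ _) ≫ p = suspensionι A x.fst x.snd ≫ b
    split_ifs with h'
    · rw [Category.assoc, hab, reassoc_of% (suspensionι_map A x.fst (t x.dim))]
      congr 2
      ext i : 3
      exact (h' _ ⟨i, rfl⟩).symm
    · rw [zero_comp, suspensionι_of_not_surjective A (hx.resolve_left h'), zero_comp])
  obtain ⟨d, hd⟩ := exists_suspension_desc_family k' fun x hx ↦ by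
    rw [h₁ x (Or.inr hx)]
    change ite _ _ _ = _
    split_ifs
    · rw [suspensionι_of_not_surjective A hx, zero_comp]
    · rfl
  refine ⟨d, suspension_hom_ext fun {m} s y ↦ ?_, suspension_hom_ext fun {m} s y ↦ ?_⟩
  · rw [reassoc_of% (suspensionι_map A s y), hd]
    have hs : ∀ q ∈ (Chain.prism s (y ≫ SimplexCategory.const ⦋0⦌ ⦋n⦌ 0)).range, q.2 = 0 := by
      rintro _ ⟨i, rfl⟩
      rfl
    refine (h₁ _ (Or.inl hs) trivial).trans ((if_pos hs).trans ?_)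
    rw [Chain.prism_fst, ht y]
  · rw [reassoc_of% (hd s y)]
    refine (h₂ (Chain.prism s y) trivial).trans ?_
    change suspensionι A (Chain.prism s y).fst (Chain.prism s y).snd ≫ b = _
    rw [Chain.prism_fst, Chain.prism_snd]

/-- The suspension of a cosimplicial resolution is a cosimplicial resolution. -/
theorem IsCosimplicialResolution.suspension_obj (hA : IsCosimplicialResolution A) :
    IsCosimplicialResolution (suspension.obj A) := by
  have h : ∀ {m n : ℕ} (f : (⦋m⦌ : SimplexCategory) ⟶ ⦋n⦌),
      WeakEquivalence ((suspension.obj A).map f) := by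
    have ht : ∀ n : ℕ, WeakEquivalence
        ((suspension.obj A).map (SimplexCategory.const ⦋n⦌ ⦋0⦌ 0)) := by
      intro n
      have := hA.weakEquivalence_suspension_const n
      have h₁ : (suspension.obj A).map (SimplexCategory.const ⦋0⦌ ⦋n⦌ 0) ≫
          (suspension.obj A).map (SimplexCategory.const ⦋n⦌ ⦋0⦌ 0) = 𝟙 _ := by
        rw [← (suspension.obj A).map_comp, ← (suspension.obj A).map_id]
        congr 1
        ext i : 3
        exact Subsingleton.elim (α := Fin 1) _ _
      exact weakEquivalence_of_precomp_of_fac h₁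
    intro m n f
    have := ht m
    have := ht n
    have h₂ : (suspension.obj A).map f ≫ (suspension.obj A).map (SimplexCategory.const ⦋n⦌ ⦋0⦌ 0) =
        (suspension.obj A).map (SimplexCategory.const ⦋m⦌ ⦋0⦌ 0) := by
      rw [← (suspension.obj A).map_comp]
      rfl
    exact weakEquivalence_of_postcomp_of_fac h₂
  exact ⟨isReedyCofibrant_suspension hA.reedyCofibrant, fun n i ↦ h _, fun n i ↦ h _⟩

end

/-! ### Weak equivalences between cofibers -/

section Cofiber

variable {C : Type u} [Category.{v} C] [ModelCategory C]

/-- The mapping cylinder of a map of cofibrant objects under `E`. -/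
lemma exists_mappingCylinder {E X Y : C} {e : E ⟶ X} {e' : E ⟶ Y} [Cofibration e]
    [Cofibration e'] {f : X ⟶ Y} (hf : e ≫ f = e') :
    ∃ (M : C) (i : X ⟶ M) (j : Y ⟶ M) (r : M ⟶ Y), Cofibration i ∧ Cofibration j ∧
      WeakEquivalence r ∧ i ≫ r = f ∧ j ≫ r = 𝟙 Y ∧ e ≫ i = e' ≫ j := by
  have hf' : e ≫ f = e' ≫ 𝟙 Y := by rw [hf, Category.comp_id]
  let M := MorphismProperty.factorizationData (cofibrations C) (trivialFibrations C)
    (pushout.desc f (𝟙 Y) hf')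
  have : Cofibration M.i := (cofibration_iff _).2 M.hi
  have : Cofibration (pushout.inl e e' : X ⟶ _) := inferInstance
  have : Cofibration (pushout.inr e e' : Y ⟶ _) := inferInstance
  refine ⟨M.Z, pushout.inl e e' ≫ M.i, pushout.inr e e' ≫ M.i, M.p, inferInstance, inferInstance,
    ((mem_trivialFibrations_iff M.p).1 M.hp).2, ?_, ?_, ?_⟩
  · rw [Category.assoc, M.fac]
    exact pushout.inl_desc _ _ _
  · rw [Category.assoc, M.fac]
    exact pushout.inr_desc _ _ _
  · rw [pushout.condition_assoc]

variable [HasZeroMorphisms C]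

/-- The map of cofibers induced by a trivial cofibration under `E` is a weak equivalence. -/
lemma weakEquivalence_cofiber_of_cofibration {E X M X' M' : C} {e : E ⟶ X} {e' : E ⟶ M}
    {c : X ⟶ X'} {w : e ≫ c = 0} (hc : IsColimit (CokernelCofork.ofπ c w)) {c' : M ⟶ M'}
    {w' : e' ≫ c' = 0} (hc' : IsColimit (CokernelCofork.ofπ c' w')) {i : X ⟶ M} [Cofibration i]
    [WeakEquivalence i] (hi : e ≫ i = e') {g : X' ⟶ M'} (hg : c ≫ g = i ≫ c') :
    WeakEquivalence g := by
  refine (trivialCofibration_of_hasLiftingProperty fun p _ ↦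
    hasLiftingProperty_of_exists fun a b hab ↦ ?_).2
  obtain ⟨d, h₁, h₂⟩ := exists_lift i p (a := c ≫ a) (b := c' ≫ b) (by
    rw [Category.assoc, hab, reassoc_of% hg])
  obtain ⟨d', h₃⟩ := CokernelCofork.IsColimit.desc' hc' d (by
    rw [← hi, Category.assoc, h₁, reassoc_of% w, zero_comp])
  change c' ≫ d' = d at h₃
  refine ⟨d', Cofork.IsColimit.hom_ext hc ?_, Cofork.IsColimit.hom_ext hc' ?_⟩
  · change c ≫ g ≫ d' = c ≫ a
    rw [reassoc_of% hg, h₃, h₁]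
  · change c' ≫ d' ≫ p = c' ≫ b
    rw [reassoc_of% h₃, h₂]

/-- The map of cofibers induced by a weak equivalence between cofibrant objects under `E` is a weak
equivalence. -/
lemma weakEquivalence_cofiber {E X Y X' Y' : C} {e : E ⟶ X} {e' : E ⟶ Y} [Cofibration e]
    [Cofibration e'] {c : X ⟶ X'} {w : e ≫ c = 0} (hc : IsColimit (CokernelCofork.ofπ c w))
    {c' : Y ⟶ Y'} {w' : e' ≫ c' = 0} (hc' : IsColimit (CokernelCofork.ofπ c' w')) {f : X ⟶ Y}
    [WeakEquivalence f] (hf : e ≫ f = e') {g : X' ⟶ Y'} (hg : c ≫ g = f ≫ c') :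
    WeakEquivalence g := by
  obtain ⟨M, i, j, q, _, _, _, hi, hj, hij⟩ := exists_mappingCylinder hf
  have : WeakEquivalence i := weakEquivalence_of_postcomp_of_fac hi
  have : WeakEquivalence j := weakEquivalence_of_postcomp_of_fac hj
  have hM : IsColimit (CokernelCofork.ofπ (cokernel.π (e' ≫ j)) (cokernel.condition _)) :=
    cokernelIsCokernel _
  obtain ⟨a, ha⟩ : ∃ a : X' ⟶ cokernel (e' ≫ j), c ≫ a = i ≫ cokernel.π (e' ≫ j) :=
    ⟨_, (CokernelCofork.IsColimit.desc' hc (i ≫ cokernel.π (e' ≫ j)) (by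
      rw [reassoc_of% hij]
      exact (Category.assoc _ _ _).symm.trans (cokernel.condition _))).2⟩
  obtain ⟨b, hb⟩ : ∃ b : Y' ⟶ cokernel (e' ≫ j), c' ≫ b = j ≫ cokernel.π (e' ≫ j) :=
    ⟨_, (CokernelCofork.IsColimit.desc' hc' (j ≫ cokernel.π (e' ≫ j))
      ((Category.assoc _ _ _).symm.trans (cokernel.condition _))).2⟩
  have := weakEquivalence_cofiber_of_cofibration hc hM hij ha
  have := weakEquivalence_cofiber_of_cofibration hc' hM rfl hb
  let r : cokernel (e' ≫ j) ⟶ Y' := cokernel.desc _ (q ≫ c') (by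
    rw [Category.assoc, reassoc_of% hj, w'])
  have hbr : b ≫ r = 𝟙 Y' := Cofork.IsColimit.hom_ext hc' (by
    change c' ≫ b ≫ r = c' ≫ 𝟙 _
    rw [reassoc_of% hb, cokernel.π_desc, reassoc_of% hj, Category.comp_id])
  have har : a ≫ r = g := Cofork.IsColimit.hom_ext hc (by
    change c ≫ a ≫ r = c ≫ g
    rw [reassoc_of% ha, cokernel.π_desc, reassoc_of% hi, hg])
  have : WeakEquivalence r := weakEquivalence_of_precomp_of_fac hbr
  rw [← har]
  infer_instance

end Cofiber

/-! ### The suspension in degree zero -/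

section DegreeZero

variable {C : Type u} [Category.{v} C] [HasZeroMorphisms C] [HasColimitsOfSize.{0, 0} C]

/-- The inclusion of the two vertices, `A⁰ ⊔ A⁰ ⟶ A¹`. -/
def endpoints (A : SimplexCategory ⥤ C) : A.obj ⦋0⦌ ⨿ A.obj ⦋0⦌ ⟶ A.obj ⦋1⦌ :=
  coprod.desc (A.map (SimplexCategory.const ⦋0⦌ ⦋1⦌ 0)) (A.map (SimplexCategory.const ⦋0⦌ ⦋1⦌ 1))

/-- The projection `A¹ ⟶ (ΣA)⁰`. -/
def suspensionπ (A : SimplexCategory ⥤ C) : A.obj ⦋1⦌ ⟶ (suspension.obj A).obj ⦋0⦌ :=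
  suspensionι A (𝟙 ⦋1⦌) (SimplexCategory.const ⦋1⦌ ⦋0⦌ 0)

lemma hom_zero_eq {m : SimplexCategory} (f : m ⟶ ⦋0⦌) : f = SimplexCategory.const m ⦋0⦌ 0 := by
  ext i : 3
  exact Subsingleton.elim (α := Fin 1) _ _

lemma map_suspensionπ (A : SimplexCategory ⥤ C) {m : SimplexCategory} (s : m ⟶ ⦋1⦌)
    (y : m ⟶ ⦋0⦌) : A.map s ≫ suspensionπ A = suspensionι A s y := by
  refine (suspensionι_face A s _ _).trans ?_
  rw [Category.comp_id, hom_zero_eq y, hom_zero_eq (s ≫ _)]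

/-- A simplex of `Δ[1]` in the boundary is constant. -/
lemma exists_const_of_not_surjective {m : SimplexCategory} {s : m ⟶ ⦋1⦌}
    (hs : ¬ Function.Surjective s.toOrderHom) :
    ∃ a : Fin 2, s = SimplexCategory.const m ⦋0⦌ 0 ≫ SimplexCategory.const ⦋0⦌ ⦋1⦌ a := by
  obtain ⟨b, hb⟩ := not_forall.1 hs
  refine ⟨1 - b, ?_⟩
  ext i : 3
  have h₁ : s.toOrderHom i ≠ b := fun h' ↦ hb ⟨i, h'⟩
  change (s.toOrderHom i : Fin 2) = 1 - b
  have h₂ : ∀ x y : Fin 2, x ≠ y → x = 1 - y := by decide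
  exact h₂ _ _ h₁

lemma endpoints_comp_eq_zero_iff {A : SimplexCategory ⥤ C} {T : C} (h : A.obj ⦋1⦌ ⟶ T) :
    endpoints A ≫ h = 0 ↔ ∀ a : Fin 2, A.map (SimplexCategory.const ⦋0⦌ ⦋1⦌ a) ≫ h = 0 := by
  constructor
  · intro h' a
    have h₀ := congrArg (coprod.inl ≫ ·) h'
    have h₁ := congrArg (coprod.inr ≫ ·) h'
    simp only [endpoints, coprod.inl_desc_assoc, coprod.inr_desc_assoc, comp_zero] at h₀ h₁
    obtain rfl | rfl : a = 0 ∨ a = 1 := by omega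
    · exact h₀
    · exact h₁
  · intro h'
    refine coprod.hom_ext ?_ ?_
    · rw [endpoints, coprod.inl_desc_assoc, h', comp_zero]
    · rw [endpoints, coprod.inr_desc_assoc, h', comp_zero]

lemma endpoints_suspensionπ (A : SimplexCategory ⥤ C) : endpoints A ≫ suspensionπ A = 0 := by
  rw [endpoints_comp_eq_zero_iff]
  intro a
  rw [map_suspensionπ A _ (𝟙 ⦋0⦌)]
  refine suspensionι_of_not_surjective A (fun h ↦ ?_) _
  obtain ⟨i, hi⟩ := h (1 - a)
  change a = 1 - a at hi
  omega

/-- `(ΣA)⁰` is the cofiber of `A⁰ ⊔ A⁰ ⟶ A¹`. -/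
def isColimitSuspensionπ (A : SimplexCategory ⥤ C) :
    IsColimit (CokernelCofork.ofπ (suspensionπ A) (endpoints_suspensionπ A)) := by
  have key : ∀ {T : C} (h : A.obj ⦋1⦌ ⟶ T), endpoints A ≫ h = 0 →
      ∃ g : (suspension.obj A).obj ⦋0⦌ ⟶ T, suspensionπ A ≫ g = h := by
    intro T h h'
    obtain ⟨g, hg⟩ := exists_suspension_desc (A := A) (n := ⦋0⦌) (fun s _ ↦ A.map s ≫ h)
      (fun s _ hs ↦ by
        obtain ⟨a, rfl⟩ := exists_const_of_not_surjective hs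
        rw [A.map_comp, Category.assoc, (endpoints_comp_eq_zero_iff h).1 h' a, comp_zero])
      (fun f s _ ↦ by rw [A.map_comp, Category.assoc])
    exact ⟨g, (hg _ _).trans (by rw [A.map_id, Category.id_comp])⟩
  refine CokernelCofork.IsColimit.ofπ _ _ (fun h h' ↦ (key h h').choose)
    (fun h h' ↦ (key h h').choose_spec) fun h h' g hg ↦ suspension_hom_ext fun s y ↦ ?_
  rw [← map_suspensionπ A s y, Category.assoc, Category.assoc, hg, (key h h').choose_spec]

lemma IsReedyCofibrant.cofibration_endpoints [ModelCategory C] {A : SimplexCategory ⥤ C}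
    (hA : IsReedyCofibrant A) : Cofibration (endpoints A) := by
  refine cofibration_of_hasLiftingProperty fun {Z W} p _ _ ↦
    hasLiftingProperty_of_exists fun a b hab ↦ ?_
  let a' (i : Fin 2) : A.obj ⦋0⦌ ⟶ Z := if i = 0 then coprod.inl ≫ a else coprod.inr ≫ a
  have ha' : ∀ i, a' i ≫ p = A.map (SimplexCategory.const ⦋0⦌ ⦋1⦌ i) ≫ b := by
    intro i
    obtain rfl | rfl : i = 0 ∨ i = 1 := by omega
    · change (coprod.inl ≫ a) ≫ p = _
      rw [Category.assoc, hab, endpoints, coprod.inl_desc_assoc]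
    · change (coprod.inr ≫ a) ≫ p = _
      rw [Category.assoc, hab, endpoints, coprod.inr_desc_assoc]
  have hconst : ∀ (x : Chain (Fin 2)), Chain.boundary 1 x → ∀ i, x.vert i = x.vert 0 := by
    intro x hx i
    obtain ⟨c, hc⟩ := not_forall.1 hx
    have h₁ : x.vert i ≠ c := fun h ↦ hc ⟨i, h⟩
    have h₂ : x.vert 0 ≠ c := fun h ↦ hc ⟨0, h⟩
    omega
  obtain ⟨d, h₁, h₂⟩ := (isReedyCofibrant_iff A).1 hA 1 p
    { hom := fun x _ ↦ A.map (SimplexCategory.const x.dim ⦋0⦌ 0) ≫ a' (x.vert 0)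
      comm := fun {x x'} f hx hx' ↦ by
        change A.map f.mor ≫ _ = _
        rw [← A.map_comp_assoc, hom_zero_eq (f.mor ≫ _), ← f.fac 0,
          hconst x' hx' (f.mor.toOrderHom 0)] } b (by
    intro x u hx
    change A.map u.mor ≫ b = _
    dsimp only
    rw [Category.assoc, ha', ← A.map_comp_assoc]
    congr 2
    ext i : 3
    exact (u.fac i).trans (hconst x hx i))
  have h₃ : ∀ i, A.map (SimplexCategory.const ⦋0⦌ ⦋1⦌ i) ≫ d = a' i := by
    intro i
    refine (h₁ ⟨⦋0⦌, ⟨fun _ ↦ i, fun _ _ _ ↦ le_rfl⟩⟩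
      ⟨SimplexCategory.const ⦋0⦌ ⦋1⦌ i, fun _ ↦ rfl⟩ fun h ↦ ?_).trans ?_
    · obtain ⟨j, hj⟩ := h (1 - i)
      exact (show ∀ x : Fin 2, x ≠ 1 - x by decide) i hj
    · dsimp only
      rw [← hom_zero_eq (𝟙 ⦋0⦌), A.map_id, Category.id_comp]
      rfl
  refine ⟨d, coprod.hom_ext ?_ ?_, h₂⟩
  · rw [endpoints, coprod.inl_desc_assoc, h₃]
    rfl
  · rw [endpoints, coprod.inr_desc_assoc, h₃]
    rfl

end DegreeZero

/-! ### Comparing `Σ(A ⊗ B)` with `ΣA ⊗ B` -/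

section Comparison

variable {C : Type u} [Category.{v} C] [HasZeroMorphisms C] [HasColimitsOfSize.{0, 0} C]
  [ModelCategory C] [MonoidalCategory C] [SymmetricCategory C] [IsMonoidalModelCategory C]

lemma zero_tensorHom {X Y : C} {X' Y' : C} (g : X' ⟶ Y') : (0 : X ⟶ Y) ⊗ₘ g = 0 := by
  -- the product with `X'` preserves the initial object, so `0 ▷ X'` factors through one
  have h : (0 : X ⟶ Y) = 0 ≫ initial.to Y := zero_comp.symm
  have h' : initial.to Y ▷ X' = 0 := (isInitialTensor' X').hom_ext _ _
  rw [MonoidalCategory.tensorHom_def, h, comp_whiskerRight, h', comp_zero, zero_comp]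

instance (X : C) : (tensorRight X).PreservesZeroMorphisms where
  map_zero Y Z := by
    change (0 : Y ⟶ Z) ▷ X = 0
    rw [← tensorHom_id, zero_tensorHom]

lemma exists_suspensionComparison (A B : SimplexCategory ⥤ C) (n : SimplexCategory) :
    ∃ g : (suspension.obj (levelTensor A B)).obj n ⟶ (suspension.obj A).obj n ⊗ B.obj n,
      ∀ {m : SimplexCategory} (s : m ⟶ ⦋1⦌) (y : m ⟶ n),
        suspensionι (levelTensor A B) s y ≫ g = suspensionι A s y ⊗ₘ B.map y :=
  exists_suspension_desc (A := levelTensor A B) (n := n) (fun s y ↦ suspensionι A s y ⊗ₘ B.map y)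
    (fun s y hs ↦ by rw [suspensionι_of_not_surjective A hs, zero_tensorHom])
    (fun f s y ↦ by rw [tensorHom_comp_tensorHom, suspensionι_face, B.map_comp])

/-- The natural map `Σ(A ⊗ B) ⟶ ΣA ⊗ B`. On the summand belonging to a simplex `(s, y)` of
`Δ[1] × Δ[n]`, it is the summand belonging to `(s, y)` tensored with `B(y)`. -/
def suspensionComparison (A B : SimplexCategory ⥤ C) :
    suspension.obj (levelTensor A B) ⟶ levelTensor (suspension.obj A) B where
  app n := (exists_suspensionComparison A B n).choose
  naturality n n' f := suspension_hom_ext fun s y ↦ by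
    have h := (exists_suspensionComparison A B n).choose_spec s y
    have h' := (exists_suspensionComparison A B n').choose_spec s (y ≫ f)
    rw [reassoc_of% (suspensionι_map (levelTensor A B) s y f), h', reassoc_of% h,
      tensorHom_comp_tensorHom, suspensionι_map, B.map_comp]

lemma suspensionι_comparison (A B : SimplexCategory ⥤ C) {m n : SimplexCategory} (s : m ⟶ ⦋1⦌)
    (y : m ⟶ n) : suspensionι (levelTensor A B) s y ≫ (suspensionComparison A B).app n =
      suspensionι A s y ⊗ₘ B.map y :=
  (exists_suspensionComparison A B n).choose_spec s y

/-- The map of levelwise products, in a form that unfolds reducibly. -/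
abbrev levelTensorMap {A A' B B' : SimplexCategory ⥤ C} (f : A ⟶ A') (g : B ⟶ B') :
    levelTensor A B ⟶ levelTensor A' B' where
  app n := f.app n ⊗ₘ g.app n
  naturality n n' h := by
    rw [tensorHom_comp_tensorHom, tensorHom_comp_tensorHom, f.naturality, g.naturality]

lemma suspensionComparison_naturality {A A' B B' : SimplexCategory ⥤ C} (f : A ⟶ A')
    (g : B ⟶ B') :
    suspension.map (levelTensorMap f g) ≫ suspensionComparison A' B' =
      suspensionComparison A B ≫ levelTensorMap (suspension.map f) g := by
  refine NatTrans.ext (funext fun n ↦ suspension_hom_ext fun s y ↦ ?_)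
  rw [NatTrans.comp_app, NatTrans.comp_app, reassoc_of% (suspensionι_app (levelTensorMap f g) s y),
    suspensionι_comparison, reassoc_of% (suspensionι_comparison A B s y)]
  rw [tensorHom_comp_tensorHom, tensorHom_comp_tensorHom, suspensionι_app, g.naturality]

/-- In degree zero, the comparison map is a map of cofibers, induced by the weak equivalence
`A¹ ⊗ B¹ ⟶ A¹ ⊗ B⁰` under the coproduct of two copies of `A⁰ ⊗ B⁰`. -/
lemma weakEquivalence_suspensionComparison_zero {A B : SimplexCategory ⥤ C}
    (hA : IsCosimplicialResolution A) (hB : IsCosimplicialResolution B) :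
    WeakEquivalence ((suspensionComparison A B).app ⦋0⦌) := by
  have hAB : IsCosimplicialResolution (levelTensor A B) := hA.tensor hB
  have := hA.reedyCofibrant.isCofibrant 1
  have := hB.reedyCofibrant.isCofibrant 0
  have := hAB.reedyCofibrant.cofibration_endpoints
  have := hA.reedyCofibrant.cofibration_endpoints
  have := cofibration_whiskerRight (endpoints A) (B.obj ⦋0⦌)
  let i : (A.obj ⦋0⦌ ⊗ B.obj ⦋0⦌) ⨿ (A.obj ⦋0⦌ ⊗ B.obj ⦋0⦌) ≅
      (A.obj ⦋0⦌ ⨿ A.obj ⦋0⦌) ⊗ B.obj ⦋0⦌ :=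
    PreservesColimitPair.iso (tensorRight (B.obj ⦋0⦌)) (A.obj ⦋0⦌) (A.obj ⦋0⦌)
  let t : B.obj ⦋1⦌ ⟶ B.obj ⦋0⦌ := B.map (SimplexCategory.const ⦋1⦌ ⦋0⦌ 0)
  have ht : ∀ a : Fin 2, B.map (SimplexCategory.const ⦋0⦌ ⦋1⦌ a) ≫ t = 𝟙 _ := fun a ↦ by
    rw [← B.map_comp, ← B.map_id]
    congr 1
    rw [hom_zero_eq (𝟙 ⦋0⦌), hom_zero_eq (_ ≫ _)]
  have : WeakEquivalence (A.obj ⦋1⦌ ◁ t) := by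
    have := hB.weakEquivalence_coface 0 0
    have := hB.cofibration_coface (n := 0) 0
    have := weakEquivalence_whiskerLeft (A.obj ⦋1⦌) (B.map (SimplexCategory.δ (n := 0) 0))
    refine weakEquivalence_of_precomp_of_fac
      (f := A.obj ⦋1⦌ ◁ B.map (SimplexCategory.δ (n := 0) 0)) (fg := 𝟙 _) ?_
    rw [← whiskerLeft_comp, ← whiskerLeft_id, ← B.map_comp, ← B.map_id]
    congr 2
    rw [hom_zero_eq (𝟙 ⦋0⦌), hom_zero_eq (_ ≫ _)]
  have hc := isColimitSuspensionπ (levelTensor A B)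
  have hc' : IsColimit (CokernelCofork.ofπ (f := i.hom ≫ endpoints A ▷ B.obj ⦋0⦌)
      (suspensionπ A ▷ B.obj ⦋0⦌) (by
        rw [Category.assoc, ← comp_whiskerRight, endpoints_suspensionπ, ← tensorHom_id,
          zero_tensorHom, comp_zero])) :=
    isCokernelEpiComp (CokernelCofork.mapIsColimit _ (isColimitSuspensionπ A)
      (tensorRight (B.obj ⦋0⦌))) i.hom rfl
  refine weakEquivalence_cofiber hc hc' (f := A.obj ⦋1⦌ ◁ t) ?_ ?_
  · have h₁ : ∀ a : Fin 2, (A.map (SimplexCategory.const ⦋0⦌ ⦋1⦌ a) ⊗ₘ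
        B.map (SimplexCategory.const ⦋0⦌ ⦋1⦌ a)) ≫ A.obj ⦋1⦌ ◁ t =
          A.map (SimplexCategory.const ⦋0⦌ ⦋1⦌ a) ▷ B.obj ⦋0⦌ := fun a ↦ by
      rw [MonoidalCategory.tensorHom_def, Category.assoc, ← whiskerLeft_comp, ht, whiskerLeft_id,
        Category.comp_id]
    have hinl : coprod.inl ≫ i.hom = coprod.inl ▷ B.obj ⦋0⦌ := by
      rw [PreservesColimitPair.iso_hom]
      exact coprodComparison_inl (tensorRight (B.obj ⦋0⦌)) (A := A.obj ⦋0⦌) (B := A.obj ⦋0⦌)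
    have hinr : coprod.inr ≫ i.hom = coprod.inr ▷ B.obj ⦋0⦌ := by
      rw [PreservesColimitPair.iso_hom]
      exact coprodComparison_inr (tensorRight (B.obj ⦋0⦌)) (A := A.obj ⦋0⦌) (B := A.obj ⦋0⦌)
    refine coprod.hom_ext ?_ ?_
    · rw [reassoc_of% hinl, ← comp_whiskerRight, endpoints, endpoints, coprod.inl_desc_assoc,
        coprod.inl_desc, h₁]
    · rw [reassoc_of% hinr, ← comp_whiskerRight, endpoints, endpoints, coprod.inr_desc_assoc,
        coprod.inr_desc, h₁]
  · refine (suspensionι_comparison A B _ _).trans ?_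
    rw [MonoidalCategory.tensorHom_def']
    rfl

lemma isLevelEquivalence_suspensionComparison {A B : SimplexCategory ⥤ C}
    (hA : IsCosimplicialResolution A) (hB : IsCosimplicialResolution B) :
    IsLevelEquivalence (suspensionComparison A B) := by
  intro n
  have hAB : IsCosimplicialResolution (levelTensor A B) := hA.tensor hB
  have h : IsCosimplicialResolution (levelTensor (suspension.obj A) B) :=
    hA.suspension_obj.tensor hB
  have := weakEquivalence_suspensionComparison_zero hA hB
  have := hAB.suspension_obj.weakEquivalence_map (SimplexCategory.const ⦋0⦌ ⦋n⦌ 0)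
  have := h.weakEquivalence_map (SimplexCategory.const ⦋0⦌ ⦋n⦌ 0)
  exact weakEquivalence_of_precomp_of_fac
    ((suspensionComparison A B).naturality (SimplexCategory.const ⦋0⦌ ⦋n⦌ 0))

end Comparison

end CosimplicialResolutions

end

theorem proposition6p4 {C : Type u} [Category.{v} C] [HasZeroObject C] [HasZeroMorphisms C]
    [HasColimitsOfSize.{0, 0} C] [ModelCategory C] [MonoidalCategory C] [SymmetricCategory C]
    [CosimplicialResolutions.IsMonoidalModelCategory C] :
    (∀ A B : SimplexCategory ⥤ C,
      CosimplicialResolutions.IsCosimplicialResolution A →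
      CosimplicialResolutions.IsCosimplicialResolution B →
      CosimplicialResolutions.IsCosimplicialResolution (A ⊗ B)) ∧
    (∀ A : SimplexCategory ⥤ C,
      CosimplicialResolutions.IsCosimplicialResolution A →
      CosimplicialResolutions.IsCosimplicialResolution
        (CosimplicialResolutions.suspension.obj A)) ∧
    (∃ φ : ∀ A B : SimplexCategory ⥤ C,
        CosimplicialResolutions.suspension.obj (A ⊗ B) ⟶
          CosimplicialResolutions.suspension.obj A ⊗ B,
      (∀ {A A' B B' : SimplexCategory ⥤ C} (f : A ⟶ A') (g : B ⟶ B'),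
        CosimplicialResolutions.suspension.map (f ⊗ₘ g) ≫ φ A' B' =
          φ A B ≫ (CosimplicialResolutions.suspension.map f ⊗ₘ g)) ∧
      ∀ A B : SimplexCategory ⥤ C,
        CosimplicialResolutions.IsCosimplicialResolution A →
        CosimplicialResolutions.IsCosimplicialResolution B →
        CosimplicialResolutions.IsLevelEquivalence (φ A B)) := by
  refine ⟨fun A B hA hB ↦ hA.tensor hB, fun A hA ↦ hA.suspension_obj,
    fun A B ↦ CosimplicialResolutions.suspensionComparison A B, fun f g ↦ ?_, fun A B hA hB ↦ ?_⟩
  · exact CosimplicialResolutions.suspensionComparison_naturality f g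
  · exact CosimplicialResolutions.isLevelEquivalence_suspensionComparison hA hB
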